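/- A right regular band of groups is a regular semigroup (for every $s$ there is $t$ with $sts=s$) in which every right ideal is two-sided. Let $S$ be a finite monoid that is a right regular band of groups, and let $k$ be an algebraically closed field whose characteristic does not divide the order of any maximal subgroup of $S$. All modules are right modules unless stated otherwise. For an idempotent $f\in S$ let $G_f$ be its maximal subgroup, that is, the group of units of the monoid $fSf$, and let $R_f=\{x\in S: xS=fS\}$; the space $kR_f$ is a $kG_f$-$kS$-bimodule, where $G_f$ acts by left multiplication and $s\in S$ sends $x\in R_f$ to $xs$ if $xs\in R_f$ and to $0$ otherwise. For a simple $kG_f$-module $W$ put $\mathrm{Ind}_f(W)=W\otimes_{kG_f}kR_f$ and $\widetilde W=\mathrm{Ind}_f(W)/\mathrm{rad}(\mathrm{Ind}_f(W))$, the simple $kS$-module with apex the $\mathscr J$-class of $f$ that corresponds to $W$. Let $J$ be the minimal ideal of $S$, let $e\in J$ be an idempotent, $H=G_e$, and let $G=G_1$ be the group of units of $S$. Let $\approx$ be the equivalence relation on $J$ generated by the pairs $(x,x')$ such that $xe=x'e$ and there is $w\in S\setminus(G\cup J)$ with $xw=x$ and $x'w=x'$. Put $X=J/{\approx}$. Then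 $H$ acts on $X$ on the left by $h[x]=[hx]$, $G$ acts on $X$ on the right by $[x]g=[xg]$, and $[x]\mapsto xe$ defines a homomorphism $\varepsilon\colon kX\to kH$ of $kH$-$kG$-bimodules, where $g\in G$ acts on $kH$ on the right as multiplication by $ge\in H$. Let $M=\ker\varepsilon$. **Theorem.** Let $U$ be a simple $kH$-module and $V$ a simple $kG$-module, so that $\widetilde U$ has apex $J$ and $\widetilde V$ has apex $G$. Then $\dim_k\mathrm{Ext}^1_{kS}(\widetilde U,\widetilde V)$ is finite and equals the multiplicity of $V$ as a composition factor of the $kG$-module $U\otimes_{kH}M$. -/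

import Mathlib

universe u v w

noncomputable section

namespace RRBG

open MulOpposite
open scoped TensorProduct

/-! ## Semigroups: principal ideals, regularity, right regular bands of groups -/

section Semigroups

variable {S : Type u}

/-- A right regular band of groups: a regular semigroup in which every right ideal is a
two-sided ideal. -/
class IsRRBG (S : Type u) [Semigroup S] : Prop where
  regular : ∀ s : S, ∃ t : S, s * t * s = s
  leftIdeal_of_rightIdeal : ∀ R : Set S,
    (∀ r ∈ R, ∀ s : S, r * s ∈ R) → ∀ r ∈ R, ∀ s : S, s * r ∈ R

/-- The principal right ideal `sS` of an element of a monoid. -/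
def rightIdeal [Monoid S] (s : S) : Set S := {x | ∃ a : S, x = s * a}

/-- The principal two-sided ideal `SsS` of an element of a monoid. -/
def twoSidedIdeal [Monoid S] (s : S) : Set S := {x | ∃ a b : S, x = a * s * b}

/-- Green's preorder `s ≤ t` in the sense of two-sided ideals: `SsS ⊆ StS`. -/
def JLE [Monoid S] (s t : S) : Prop := twoSidedIdeal s ⊆ twoSidedIdeal t

/-- The minimal ideal of a (finite) monoid: the elements lying `J`-below every element. -/
def minimalIdeal (S : Type u) [Monoid S] : Set S := {x | ∀ s : S, JLE x s}

/-- The idempotents `E(S)`. -/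
abbrev Idem (S : Type u) [Mul S] : Type u := {e : S // IsIdempotentElem e}

/-- The identity, as an idempotent. -/
def oneIdem (S : Type u) [Monoid S] : Idem S := ⟨1, IsIdempotentElem.one⟩

/-- The local monoid `eSe` at an idempotent `e`. -/
@[ext] structure LocalMonoid [Monoid S] (e : Idem S) : Type u where
  val : S
  mem : ∃ t : S, val = e.1 * t * e.1

section LocalMonoid

variable [Monoid S] {e : Idem S}

theorem LocalMonoid.left (x : LocalMonoid e) : e.1 * x.val = x.val := by
  obtain ⟨t, ht⟩ := x.mem
  rw [ht, ← mul_assoc, ← mul_assoc, e.2.eq]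

theorem LocalMonoid.right (x : LocalMonoid e) : x.val * e.1 = x.val := by
  obtain ⟨t, ht⟩ := x.mem
  rw [ht, mul_assoc, e.2.eq]

instance : Monoid (LocalMonoid e) where
  mul x y := ⟨x.val * y.val, x.val * y.val, by
    rw [← mul_assoc, x.left, mul_assoc, y.right]⟩
  mul_assoc x y z := LocalMonoid.ext (mul_assoc x.val y.val z.val)
  one := ⟨e.1, e.1, by rw [e.2.eq, e.2.eq]⟩
  one_mul x := LocalMonoid.ext x.left
  mul_one x := LocalMonoid.ext x.right

end LocalMonoid

/-- The maximal subgroup `G_e` of `S` at the idempotent `e`: the group of units of `eSe`.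
For `e = 1` this is the group of units of `S`. -/
abbrev MaxSubgroup [Monoid S] (e : Idem S) : Type u := (LocalMonoid e)ˣ

/-- The element of `S` underlying an element of a maximal subgroup. -/
def MaxSubgroup.toS [Monoid S] {e : Idem S} (g : MaxSubgroup e) : S := g.val.val

section MaxSubgroup

variable [Monoid S] {e : Idem S}

theorem MaxSubgroup.toS_mul (g h : MaxSubgroup e) : (g * h).toS = g.toS * h.toS := rfl

theorem MaxSubgroup.toS_one : (1 : MaxSubgroup e).toS = e.1 := rfl

theorem MaxSubgroup.left (g : MaxSubgroup e) : e.1 * g.toS = g.toS := g.val.left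

theorem MaxSubgroup.right (g : MaxSubgroup e) : g.toS * e.1 = g.toS := g.val.right

theorem MaxSubgroup.mul_inv' (g : MaxSubgroup e) : g.toS * g⁻¹.toS = e.1 := by
  rw [← MaxSubgroup.toS_mul, mul_inv_cancel, MaxSubgroup.toS_one]

theorem MaxSubgroup.inv_mul' (g : MaxSubgroup e) : g⁻¹.toS * g.toS = e.1 := by
  rw [← MaxSubgroup.toS_mul, inv_mul_cancel, MaxSubgroup.toS_one]

theorem MaxSubgroup.toS_injective :
    Function.Injective (MaxSubgroup.toS : MaxSubgroup e → S) :=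
  fun _ _ h => Units.ext (LocalMonoid.ext h)

theorem rightIdeal_subset_iff {s t : S} :
    rightIdeal s ⊆ rightIdeal t ↔ ∃ a, s = t * a := by
  constructor
  · intro h
    exact h ⟨1, (mul_one s).symm⟩
  · rintro ⟨a, rfl⟩ x ⟨b, rfl⟩
    exact ⟨a * b, mul_assoc _ _ _⟩

theorem JLE_iff {s t : S} : JLE s t ↔ ∃ a b, s = a * t * b := by
  constructor
  · intro h
    exact h ⟨1, 1, by simp⟩
  · rintro ⟨a, b, rfl⟩ x ⟨c, d, rfl⟩
    exact ⟨c * a, b * d, by simp only [mul_assoc]⟩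

theorem isUnit_of_inverses {s t : S} (h1 : s * t = 1) (h2 : t * s = 1) : IsUnit s :=
  ⟨⟨s, t, h1, h2⟩, rfl⟩

theorem minimalIdeal_mul_right {x : S} (hx : x ∈ minimalIdeal S) (s : S) :
    x * s ∈ minimalIdeal S := fun t => by
  obtain ⟨a, b, h⟩ := JLE_iff.1 (hx t)
  exact JLE_iff.2 ⟨a, b * s, by rw [← mul_assoc, ← h]⟩

theorem minimalIdeal_mul_left {x : S} (hx : x ∈ minimalIdeal S) (s : S) :
    s * x ∈ minimalIdeal S := fun t => by
  obtain ⟨a, b, h⟩ := JLE_iff.1 (hx t)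
  exact JLE_iff.2 ⟨s * a, b, by rw [mul_assoc s, mul_assoc s, ← h]⟩

end MaxSubgroup

section RRBGLemmas

variable [Monoid S] [IsRRBG S]

theorem IsRRBG.exists_mul (s x : S) : ∃ a, s * x = x * a :=
  IsRRBG.leftIdeal_of_rightIdeal (rightIdeal x)
    (by rintro r ⟨a, rfl⟩ s; exact ⟨a * s, mul_assoc _ _ _⟩) x ⟨1, (mul_one x).symm⟩ s

theorem IsRRBG.idem_mul (e : Idem S) (s : S) : e.1 * (s * e.1) = s * e.1 := by
  obtain ⟨a, ha⟩ := IsRRBG.exists_mul s e.1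
  rw [ha, ← mul_assoc, e.2.eq]

/-- For `e` in the minimal ideal, the product `xe` lies in the maximal
subgroup at `e`. -/
theorem exists_maxSubgroup (e : Idem S) (he : e.1 ∈ minimalIdeal S) (x : S) : ∃ h : MaxSubgroup e, h.toS = x * e.1 := by
  have key : ∀ y : LocalMonoid e, ∃ z : LocalMonoid e, y * z = 1 := by
    intro y
    obtain ⟨a, b, hab⟩ := JLE_iff.1 (he y.val)
    obtain ⟨c, hc⟩ := IsRRBG.exists_mul a y.val
    refine ⟨⟨e.1 * (c * b) * e.1, c * b, rfl⟩, LocalMonoid.ext ?_⟩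
    change y.val * (e.1 * (c * b) * e.1) = e.1
    rw [← mul_assoc, ← mul_assoc, y.right, ← mul_assoc, ← hc, ← hab, e.2.eq]
  have hmem : ∃ t, x * e.1 = e.1 * t * e.1 :=
    ⟨x, by rw [mul_assoc, IsRRBG.idem_mul]⟩
  obtain ⟨z, hz⟩ := key ⟨x * e.1, hmem⟩
  obtain ⟨y, hy⟩ := key z
  have hyx : y = ⟨x * e.1, hmem⟩ := by
    rw [← one_mul y, ← hz, mul_assoc, hy, mul_one]
  rw [hyx] at hy
  exact ⟨⟨⟨x * e.1, hmem⟩, z, hz, hy⟩, rfl⟩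

end RRBGLemmas

end Semigroups

/-! ## Right modules

A right module over a ring `A` is a module over `Aᵐᵒᵖ`. -/

section Modules

variable (k : Type u) [Field k]

/-- The left `kT`-module structure given by a representation of `T` on `W`. -/
abbrev leftModuleOfRep {T : Type v} [Monoid T] {W : Type w} [AddCommGroup W] [Module k W]
    (ρ : T →* Module.End k W) : Module (MonoidAlgebra k T) W :=
  Module.compHom W (MonoidAlgebra.lift k (Module.End k W) T ρ).toRingHom

/-- The right `kT`-module structure given by an anti-representation of `T` on `W`. -/
abbrev rightModuleOfRep {T : Type v} [Monoid T] {W : Type w} [AddCommGroup W] [Module k W]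
    (σ : T →* (Module.End k W)ᵐᵒᵖ) : Module (MonoidAlgebra k T)ᵐᵒᵖ W :=
  Module.compHom W
    (AlgHom.opComm (MonoidAlgebra.lift k (Module.End k W)ᵐᵒᵖ T σ)).toRingHom

/-- The tensor product `U ⊗_B M` of a right `B`-module `U` and a `B`-`A`-bimodule `M` over
`k`-algebras `A` and `B`, as a right `A`-module.  It is the quotient of the tensor product
over `k` (written with the factors interchanged) by the relations `ub ⊗ m = u ⊗ bm`. -/
abbrev BalancedTensor {B : Type*} [Ring B] (A : Type*) [Ring A] [Algebra k A]
    (U : Type*) [AddCommGroup U] [Module k U] [Module Bᵐᵒᵖ U]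
    (M : Type*) [AddCommGroup M] [Module k M] [Module B M] [Module Aᵐᵒᵖ M]
    [IsScalarTower k Aᵐᵒᵖ M] : Type _ :=
  (M ⊗[k] U) ⧸ Submodule.span Aᵐᵒᵖ
    {z : M ⊗[k] U | ∃ (u : U) (b : B) (m : M), z = m ⊗ₜ[k] (op b • u) - (b • m) ⊗ₜ[k] u}

/-- `m` is the multiplicity of `V` as a composition factor of `N`: the module `N` has a
composition series, and every composition series of `N` has exactly `m` factors isomorphic
to `V`. -/
def IsCompositionMultiplicity (R : Type*) [Ring R] (V : Type*) [AddCommGroup V] [Module R V]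
    (N : Type*) [AddCommGroup N] [Module R N] (m : ℕ) : Prop :=
  (∃ s : CompositionSeries (Submodule R N), s.head = ⊥ ∧ s.last = ⊤) ∧
  ∀ s : CompositionSeries (Submodule R N), s.head = ⊥ → s.last = ⊤ →
    Nat.card {i : Fin s.length //
      Nonempty ((s i.succ ⧸ (s i.castSucc).submoduleOf (s i.succ)) ≃ₗ[R] V)} = m

end Modules

/-! ## Induced modules and the simple modules with a given apex -/

section Induced

variable (k : Type u) [Field k] {S : Type u} [Monoid S]

/-- The `R`-class of an idempotent `e`. -/
@[ext] structure RClass (e : Idem S) : Type u where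
  val : S
  mem : rightIdeal val = rightIdeal e.1

theorem RClass.mul_of_mul (e : Idem S) (x : RClass e) (s t : S)
    (h : rightIdeal (x.val * (s * t)) = rightIdeal e.1) :
    rightIdeal (x.val * s) = rightIdeal e.1 := by
  apply subset_antisymm
  · exact (rightIdeal_subset_iff.2 ⟨s, rfl⟩).trans x.mem.subset
  · exact h.symm.subset.trans (rightIdeal_subset_iff.2 ⟨t, (mul_assoc _ _ _).symm⟩)

theorem RClass.maxSubgroup_mul (e : Idem S) (g : MaxSubgroup e) (x : RClass e) :
    rightIdeal (g.toS * x.val) = rightIdeal e.1 := by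
  obtain ⟨a, ha⟩ := rightIdeal_subset_iff.1 x.mem.symm.subset
  apply subset_antisymm
  · exact rightIdeal_subset_iff.2 ⟨g.toS * x.val, by rw [← mul_assoc, g.left]⟩
  · refine rightIdeal_subset_iff.2 ⟨a * g⁻¹.toS, ?_⟩
    rw [mul_assoc, ← mul_assoc x.val, ← ha, ← mul_assoc, g.right, g.mul_inv']

/-- The vector space `kR` with basis the `R`-class `R` of the idempotent `e`. -/
abbrev KR (e : Idem S) : Type u := RClass e →₀ k


open Classical in
/-- The effect of `s ∈ S` on a basis vector `x` of `kR`: it is `xs` if `xs ∈ R`, and `0`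
otherwise. -/
def KR.act (e : Idem S) (s : S) (x : RClass e) : KR k e :=
  if h : rightIdeal (x.val * s) = rightIdeal e.1 then Finsupp.single ⟨x.val * s, h⟩ 1 else 0

/-- The right Schützenberger representation of `S` on `kR`. -/
def KR.rightRep (e : Idem S) : S →* (Module.End k (KR k e))ᵐᵒᵖ where
  toFun s := op (Finsupp.linearCombination k (KR.act k e s))
  map_one' := by
    apply unop_injective
    refine Finsupp.lhom_ext' fun x => LinearMap.ext_ring ?_
    have h : rightIdeal (x.val * 1) = rightIdeal e.1 := by rw [mul_one]; exact x.mem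
    change Finsupp.linearCombination k (KR.act k e 1) (Finsupp.single x 1) = Finsupp.single x 1
    rw [Finsupp.linearCombination_single, one_smul, KR.act, dif_pos h]
    congr 1
    exact RClass.ext (mul_one x.val)
  map_mul' s t := by
    apply unop_injective
    refine Finsupp.lhom_ext' fun x => LinearMap.ext_ring ?_
    change Finsupp.linearCombination k (KR.act k e (s * t)) (Finsupp.single x 1) =
      Finsupp.linearCombination k (KR.act k e t)
        (Finsupp.linearCombination k (KR.act k e s) (Finsupp.single x 1))
    rw [Finsupp.linearCombination_single, Finsupp.linearCombination_single, one_smul, one_smul]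
    by_cases hs : rightIdeal (x.val * s) = rightIdeal e.1
    · rw [show KR.act k e s x = Finsupp.single ⟨x.val * s, hs⟩ 1 from dif_pos hs]
      rw [Finsupp.linearCombination_single, one_smul]
      simp only [KR.act, mul_assoc]
    · have hst : ¬ rightIdeal (x.val * (s * t)) = rightIdeal e.1 :=
        fun h => hs (RClass.mul_of_mul e x s t h)
      rw [show KR.act k e s x = 0 from dif_neg hs, map_zero]
      exact dif_neg hst

/-- The action of the maximal subgroup `G_e` on `kR` by left multiplication. -/
def KR.leftRep (e : Idem S) : MaxSubgroup e →* Module.End k (KR k e) where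
  toFun g := Finsupp.lmapDomain k k
    (fun x : RClass e => (⟨g.toS * x.val, RClass.maxSubgroup_mul e g x⟩ : RClass e))
  map_one' := by
    refine Finsupp.lhom_ext' fun x => LinearMap.ext_ring ?_
    change Finsupp.mapDomain _ (Finsupp.single x 1) = Finsupp.single x 1
    rw [Finsupp.mapDomain_single]
    congr 1
    obtain ⟨a, ha⟩ := rightIdeal_subset_iff.1 x.mem.subset
    refine RClass.ext ?_
    change e.1 * x.val = x.val
    rw [ha, ← mul_assoc, e.2.eq]
  map_mul' g h := by
    refine Finsupp.lhom_ext' fun x => LinearMap.ext_ring ?_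
    change Finsupp.mapDomain _ (Finsupp.single x 1) =
      Finsupp.mapDomain _ (Finsupp.mapDomain _ (Finsupp.single x 1))
    simp only [Finsupp.mapDomain_single, MaxSubgroup.toS_mul, mul_assoc]

/-- `kR` as a left `kG_e`-module. -/
instance (e : Idem S) : Module (MonoidAlgebra k (MaxSubgroup e)) (KR k e) :=
  leftModuleOfRep k (KR.leftRep k e)

/-- `kR` as a right `kS`-module. -/
instance (e : Idem S) : Module (MonoidAlgebra k S)ᵐᵒᵖ (KR k e) :=
  rightModuleOfRep k (KR.rightRep k e)

instance (e : Idem S) : IsScalarTower k (MonoidAlgebra k S)ᵐᵒᵖ (KR k e) where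
  smul_assoc c a x := by
    change AlgHom.opComm (MonoidAlgebra.lift k _ S (KR.rightRep k e)) (c • a) x =
      c • AlgHom.opComm (MonoidAlgebra.lift k _ S (KR.rightRep k e)) a x
    rw [map_smul, LinearMap.smul_apply]

/-- The induced right `kS`-module `Ind(V) = V ⊗_{kG_e} kR` of a right `kG_e`-module `V`. -/
abbrev Ind (e : Idem S) (V : Type u) [AddCommGroup V] [Module k V]
    [Module (MonoidAlgebra k (MaxSubgroup e))ᵐᵒᵖ V] : Type u :=
  BalancedTensor k (B := MonoidAlgebra k (MaxSubgroup e)) (MonoidAlgebra k S) V (KR k e)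

/-- The right `kS`-module `Ṽ = Ind(V) / rad(Ind(V))`; for `V` simple it is the simple
`kS`-module with apex the `J`-class of `e` corresponding to `V`. -/
abbrev Tilde (e : Idem S) (V : Type u) [AddCommGroup V] [Module k V]
    [Module (MonoidAlgebra k (MaxSubgroup e))ᵐᵒᵖ V] : Type u :=
  Ind k e V ⧸ Module.jacobson (MonoidAlgebra k S)ᵐᵒᵖ (Ind k e V)

end Induced

/-! ## The bimodule `M` -/

section Bimodule

variable {S : Type u} [Monoid S]

/-- The idempotents of the minimal ideal. -/
abbrev MinIdem (S : Type u) [Monoid S] : Type u := {e : Idem S // e.1 ∈ minimalIdeal S}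

/-- The relation `x ⌣ x'` on the minimal ideal `J`: `xe = x'e`, and there is a non-unit `w`
outside `J` with `xw = x` and `x'w = x'`. -/
def Smile (e : MinIdem S) (x x' : minimalIdeal S) : Prop :=
  x.1 * e.1.1 = x'.1 * e.1.1 ∧
    ∃ w : S, ¬ IsUnit w ∧ w ∉ minimalIdeal S ∧ x.1 * w = x.1 ∧ x'.1 * w = x'.1

/-- The equivalence relation `≈` on the minimal ideal generated by `⌣`. -/
def approx (e : MinIdem S) : Setoid (minimalIdeal S) := Relation.EqvGen.setoid (Smile e)

/-- The set `X = J/≈`. -/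
abbrev X (e : MinIdem S) : Type u := Quotient (approx e)

theorem approx_map (e : MinIdem S) (f : minimalIdeal S → minimalIdeal S)
    (hf : ∀ x y, Smile e x y → Smile e (f x) (f y)) (x y : minimalIdeal S)
    (h : (approx e).r x y) : (approx e).r (f x) (f y) := by
  change Relation.EqvGen (Smile e) x y at h
  change Relation.EqvGen (Smile e) (f x) (f y)
  induction h with
  | rel x y h => exact .rel _ _ (hf x y h)
  | refl x => exact .refl _
  | symm x y _ ih => exact .symm _ _ ih
  | trans x y z _ _ h1 h2 => exact .trans _ _ _ h1 h2

theorem approx_mul_eq (e : MinIdem S) (x y : minimalIdeal S) (h : (approx e).r x y) :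
    x.1 * e.1.1 = y.1 * e.1.1 := by
  change Relation.EqvGen (Smile e) x y at h
  induction h with
  | rel x y h => exact h.1
  | refl x => rfl
  | symm x y _ ih => exact ih.symm
  | trans x y z _ _ h1 h2 => exact h1.trans h2

theorem minIdem_mul [IsRRBG S] (e : MinIdem S) (x : minimalIdeal S) :
    e.1.1 * x.1 = x.1 := by
  obtain ⟨a, b, hab⟩ := JLE_iff.1 (x.2 e.1.1)
  rw [hab, ← mul_assoc, IsRRBG.idem_mul]

/-- The left action `h[x] = [hx]` of the maximal subgroup `H` at `e` on `X`. -/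
def X.left (e : MinIdem S) (h : MaxSubgroup e.1) : X e → X e :=
  Quotient.map (fun x => ⟨h.toS * x.1, minimalIdeal_mul_left x.2 _⟩)
    (approx_map e _ (by
      rintro x y ⟨hxy, w, hw, hwJ, hx, hy⟩
      exact ⟨by simp only [mul_assoc, hxy], w, hw, hwJ,
        by simp only [mul_assoc, hx], by simp only [mul_assoc, hy]⟩))

/-- The right action `[x]g = [xg]` of the group of units `G` on `X`. -/
def X.right [IsRRBG S] (e : MinIdem S) (g : MaxSubgroup (oneIdem S)) : X e → X e :=
  Quotient.map (fun x => ⟨x.1 * g.toS, minimalIdeal_mul_right x.2 _⟩)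
    (approx_map e _ (by
      rintro x y ⟨hxy, w, hw, hwJ, hx, hy⟩
      have h1 : g.toS * g⁻¹.toS = 1 := g.mul_inv'
      have h2 : g⁻¹.toS * g.toS = 1 := g.inv_mul'
      have hconj : g.toS * (g⁻¹.toS * w * g.toS) * g⁻¹.toS = w := by
        calc _ = (g.toS * g⁻¹.toS) * w * (g.toS * g⁻¹.toS) := by simp only [mul_assoc]
          _ = w := by rw [h1, one_mul, mul_one]
      have hfix : ∀ z : S, z * w = z → z * g.toS * (g⁻¹.toS * w * g.toS) = z * g.toS := by
        intro z hz
        calc _ = z * (g.toS * g⁻¹.toS) * w * g.toS := by simp only [mul_assoc]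
          _ = z * g.toS := by rw [h1, mul_one, hz]
      refine ⟨?_, g⁻¹.toS * w * g.toS, fun hu => hw ?_, fun hJ => hwJ ?_, hfix _ hx, hfix _ hy⟩
      · change x.1 * g.toS * e.1.1 = y.1 * g.toS * e.1.1
        rw [mul_assoc, mul_assoc, ← IsRRBG.idem_mul, ← mul_assoc, ← mul_assoc y.1, hxy]
      · rw [← hconj]
        exact ((isUnit_of_inverses h1 h2).mul hu).mul (isUnit_of_inverses h2 h1)
      · rw [← hconj]
        exact minimalIdeal_mul_right (minimalIdeal_mul_left hJ _) _))

/-- The map `X → H`, `[x] ↦ xe`. -/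
def X.toH [IsRRBG S] (e : MinIdem S) : X e → MaxSubgroup e.1 :=
  Quotient.lift (fun x => (exists_maxSubgroup e.1 e.2 x.1).choose) (by
    intro x y h
    apply MaxSubgroup.toS_injective
    rw [(exists_maxSubgroup e.1 e.2 x.1).choose_spec,
      (exists_maxSubgroup e.1 e.2 y.1).choose_spec]
    exact approx_mul_eq e x y h)

theorem X.toH_mk [IsRRBG S] (e : MinIdem S) (x : minimalIdeal S) :
    (X.toH e ⟦x⟧).toS = x.1 * e.1.1 :=
  (exists_maxSubgroup e.1 e.2 x.1).choose_spec

variable [IsRRBG S] (k : Type u) [Field k]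

/-- The vector space `kX` with basis `X`. -/
abbrev KX (e : MinIdem S) : Type u := X e →₀ k

/-- The left representation of `H` on `kX`. -/
def KX.leftRep (e : MinIdem S) : MaxSubgroup e.1 →* Module.End k (KX k e) where
  toFun h := Finsupp.lmapDomain k k (X.left e h)
  map_one' := by
    have h : X.left e 1 = id := by
      funext x
      induction x using Quotient.inductionOn with | _ x => ?_
      exact congrArg (fun y => (⟦y⟧ : X e)) (Subtype.ext (minIdem_mul e x))
    rw [h, Finsupp.lmapDomain_id]
    rfl
  map_mul' g h := by
    have h : X.left e (g * h) = X.left e g ∘ X.left e h := by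
      funext x
      induction x using Quotient.inductionOn with | _ x => ?_
      exact congrArg (fun y => (⟦y⟧ : X e)) (Subtype.ext (mul_assoc _ _ _))
    rw [h, Finsupp.lmapDomain_comp]
    rfl

/-- The right representation of `G` on `kX`. -/
def KX.rightRep (e : MinIdem S) :
    MaxSubgroup (oneIdem S) →* (Module.End k (KX k e))ᵐᵒᵖ where
  toFun g := op (Finsupp.lmapDomain k k (X.right e g))
  map_one' := by
    have h : X.right e 1 = id := by
      funext x
      induction x using Quotient.inductionOn with | _ x => ?_
      exact congrArg (fun y => (⟦y⟧ : X e)) (Subtype.ext (mul_one _))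
    rw [h, Finsupp.lmapDomain_id]
    rfl
  map_mul' g h := by
    have h : X.right e (g * h) = X.right e h ∘ X.right e g := by
      funext x
      induction x using Quotient.inductionOn with | _ x => ?_
      exact congrArg (fun y => (⟦y⟧ : X e)) (Subtype.ext (mul_assoc _ _ _).symm)
    rw [h, Finsupp.lmapDomain_comp]
    rfl

/-- `kX` as a left `kH`-module. -/
instance (e : MinIdem S) : Module (MonoidAlgebra k (MaxSubgroup e.1)) (KX k e) :=
  leftModuleOfRep k (KX.leftRep k e)

/-- `kX` as a right `kG`-module. -/
instance (e : MinIdem S) : Module (MonoidAlgebra k (MaxSubgroup (oneIdem S)))ᵐᵒᵖ (KX k e) :=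
  rightModuleOfRep k (KX.rightRep k e)

/-- The linear map `ε : kX → kH` with `[x] ↦ xe`. -/
def eps (e : MinIdem S) : KX k e →ₗ[k] MonoidAlgebra k (MaxSubgroup e.1) :=
  Finsupp.linearCombination k (fun x => MonoidAlgebra.single (X.toH e x) 1)

theorem eps_single (e : MinIdem S) (x : X e) (c : k) :
    eps k e (Finsupp.single x c) = MonoidAlgebra.single (X.toH e x) c := by
  rw [eps, Finsupp.linearCombination_single, MonoidAlgebra.smul_single, smul_eq_mul, mul_one]

theorem X.toH_left (e : MinIdem S) (h : MaxSubgroup e.1) (x : X e) :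
    X.toH e (X.left e h x) = h * X.toH e x := by
  induction x using Quotient.inductionOn with | _ x => ?_
  apply MaxSubgroup.toS_injective
  rw [MaxSubgroup.toS_mul, X.toH_mk, ← mul_assoc]
  exact X.toH_mk e ⟨h.toS * x.1, _⟩

/-- The homomorphism `ψ : G → H`, `g ↦ ge`, as a map. -/
def psi (e : MinIdem S) (g : MaxSubgroup (oneIdem S)) : MaxSubgroup e.1 :=
  (exists_maxSubgroup e.1 e.2 g.toS).choose

theorem psi_toS (e : MinIdem S) (g : MaxSubgroup (oneIdem S)) :
    (psi e g).toS = g.toS * e.1.1 :=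
  (exists_maxSubgroup e.1 e.2 g.toS).choose_spec

theorem X.toH_right (e : MinIdem S) (g : MaxSubgroup (oneIdem S)) (x : X e) :
    X.toH e (X.right e g x) = X.toH e x * psi e g := by
  induction x using Quotient.inductionOn with | _ x => ?_
  apply MaxSubgroup.toS_injective
  rw [MaxSubgroup.toS_mul, X.toH_mk, psi_toS, mul_assoc x.1, IsRRBG.idem_mul, ← mul_assoc]
  exact X.toH_mk e ⟨x.1 * g.toS, _⟩

theorem KX.single_smul (e : MinIdem S) (h : MaxSubgroup e.1) (c d : k) (x : X e) :
    (MonoidAlgebra.single h c : MonoidAlgebra k (MaxSubgroup e.1)) •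
      (Finsupp.single x d : KX k e) = Finsupp.single (X.left e h x) (c * d) := by
  change MonoidAlgebra.lift k _ _ (KX.leftRep k e) (MonoidAlgebra.single h c)
    (Finsupp.single x d) = _
  rw [MonoidAlgebra.lift_single, LinearMap.smul_apply]
  change c • Finsupp.mapDomain _ (Finsupp.single x d) = _
  rw [Finsupp.mapDomain_single, Finsupp.smul_single, smul_eq_mul]

theorem KX.op_single_smul (e : MinIdem S) (g : MaxSubgroup (oneIdem S)) (c d : k) (x : X e) :
    op (MonoidAlgebra.single g c : MonoidAlgebra k (MaxSubgroup (oneIdem S))) •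
      (Finsupp.single x d : KX k e) = Finsupp.single (X.right e g x) (c * d) := by
  change (MonoidAlgebra.lift k _ _ (KX.rightRep k e) (MonoidAlgebra.single g c)).unop
    (Finsupp.single x d) = _
  rw [MonoidAlgebra.lift_single, unop_smul, LinearMap.smul_apply]
  change c • Finsupp.mapDomain _ (Finsupp.single x d) = _
  rw [Finsupp.mapDomain_single, Finsupp.smul_single, smul_eq_mul]

/-- `ε` is a homomorphism of left `kH`-modules. -/
theorem eps_left (e : MinIdem S) (a : MonoidAlgebra k (MaxSubgroup e.1)) (m : KX k e) :
    eps k e (a • m) = a * eps k e m := by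
  induction m using Finsupp.induction_linear with
  | zero => rw [smul_zero, map_zero, mul_zero]
  | add m n hm hn => rw [smul_add, map_add, map_add, hm, hn, mul_add]
  | single x d =>
    induction a using MonoidAlgebra.induction_linear with
    | zero => rw [zero_smul, map_zero, zero_mul]
    | add a b ha hb => rw [add_smul, map_add, ha, hb, add_mul]
    | single h c =>
      rw [KX.single_smul, eps_single, eps_single, MonoidAlgebra.single_mul_single, X.toH_left]

/-- `ε` is a homomorphism of right `kG`-modules, where `G` acts on `kH` through `g ↦ ge`. -/
theorem eps_right (e : MinIdem S) (a : MonoidAlgebra k (MaxSubgroup (oneIdem S)))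
    (m : KX k e) :
    eps k e (op a • m) = eps k e m * MonoidAlgebra.mapDomain (psi e) a := by
  induction m using Finsupp.induction_linear with
  | zero => rw [smul_zero, map_zero, zero_mul]
  | add m n hm hn => rw [smul_add, map_add, map_add, hm, hn, add_mul]
  | single x d =>
    induction a using MonoidAlgebra.induction_linear with
    | zero => rw [op_zero, zero_smul, map_zero, MonoidAlgebra.mapDomain_zero, mul_zero]
    | add a b ha hb =>
      rw [op_add, add_smul, map_add, ha, hb, MonoidAlgebra.mapDomain_add, mul_add]
    | single g c =>
      rw [KX.op_single_smul, eps_single, eps_single, MonoidAlgebra.mapDomain_single,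
        MonoidAlgebra.single_mul_single, X.toH_right, mul_comm c d]

/-- The `kH`-`kG`-bimodule `M`, the kernel of `ε : kX → kH`. -/
abbrev BimodM (e : MinIdem S) : Type u := LinearMap.ker (eps k e)

instance (e : MinIdem S) : SMul (MonoidAlgebra k (MaxSubgroup e.1)) (BimodM k e) where
  smul a m := ⟨a • (m : KX k e), by
    rw [LinearMap.mem_ker, eps_left, LinearMap.mem_ker.1 m.2, mul_zero]⟩

instance (e : MinIdem S) :
    SMul (MonoidAlgebra k (MaxSubgroup (oneIdem S)))ᵐᵒᵖ (BimodM k e) where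
  smul a m := ⟨a • (m : KX k e), by
    rw [LinearMap.mem_ker, ← op_unop a, eps_right, LinearMap.mem_ker.1 m.2, zero_mul]⟩

/-- `M` as a left `kH`-submodule of `kX`. -/
instance (e : MinIdem S) : Module (MonoidAlgebra k (MaxSubgroup e.1)) (BimodM k e) :=
  Function.Injective.module _ (LinearMap.ker (eps k e)).subtype.toAddMonoidHom
    Subtype.val_injective (fun _ _ => rfl)

/-- `M` as a right `kG`-submodule of `kX`. -/
instance (e : MinIdem S) :
    Module (MonoidAlgebra k (MaxSubgroup (oneIdem S)))ᵐᵒᵖ (BimodM k e) :=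
  Function.Injective.module _ (LinearMap.ker (eps k e)).subtype.toAddMonoidHom
    Subtype.val_injective (fun _ _ => rfl)

instance (e : MinIdem S) :
    IsScalarTower k (MonoidAlgebra k (MaxSubgroup (oneIdem S)))ᵐᵒᵖ (BimodM k e) where
  smul_assoc c a x := by
    apply Subtype.ext
    change AlgHom.opComm (MonoidAlgebra.lift k _ _ (KX.rightRep k e)) (c • a) x.1 =
      c • AlgHom.opComm (MonoidAlgebra.lift k _ _ (KX.rightRep k e)) a x.1
    rw [map_smul, LinearMap.smul_apply]

end Bimodule

end RRBG

end

noncomputable section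

namespace RRBG

open MulOpposite
open scoped TensorProduct

/-! ## Dimension shifting and composition multiplicities -/

section Homological

open CategoryTheory

/-! Write `P = Ind_e(U)`. In a right regular band of groups `sx` always lies in `xS`, so `J` is a
single `R`-class, `ex = x` for `x` in `J`, and `se = ese` for every `s`. Because `J` is one
`R`-class, no product is cut off to zero in `kR_e`, and `P` is generated by the copy `U ⊗ e` of `U`.
Averaging over `H`, whose order is invertible in `k`, shows that `P` is projective
(`projective_ind_min`), and its radical is `K = {t : te = 0}` (`jacobson_ind_min`).

The module `Ṽ` is `V` with the non-units acting as zero (`exists_equiv_tilde_one`), and every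
homomorphism `P → Ṽ` vanishes on `K` (`map_eq_zero_of_mem_indKer`). The long exact sequence of `0 →
K → P → P/K → 0` therefore identifies `Ext¹(Ũ, Ṽ)` with `Hom(K, Ṽ)` (`rank_ext_one_quotient`).

A homomorphism `K → Ṽ` must kill `Kw` for every non-unit `w`, and what remains of `K` is `U ⊗ M`,
through `u ⊗ x ↦ u ⊗ ([x] - [xe])` (`rank_hom_indKer`). This is where `≈` comes from. If `xe = x'e`
and `w` fixes both `x` and `x'`, then `u ⊗ x - u ⊗ x'` lies in `K` and is fixed by `w`, so it is
killed. Conversely, if `xe = x'e` and `w` is a non-unit, regularity gives `xw ≈ x'w`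
(`mk_minMul_eq_of_not_isUnit`), so the map to `U ⊗ M` does kill `Kw`.

Finally `kG` is semisimple by Maschke's theorem, and over an algebraically closed field the
multiplicity of `V` in a finite-dimensional module is the dimension of the space of homomorphisms to
`V` (`isCompositionMultiplicity_finrank_hom`). -/

/-- If `P` is projective and every homomorphism `P → N` vanishes on `K ≤ P`, then
`Ext¹(P ⧸ K, N)` and `Hom(K, N)` have the same dimension. -/
theorem rank_ext_one_quotient {k : Type u} [Field k] {A : Type u} [Ring A] [Algebra k A]
    {P N : Type u} [AddCommGroup P] [Module A P] [Module.Projective A P]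
    [AddCommGroup N] [Module k N] [Module A N] [IsScalarTower k A N] (K : Submodule A P)
    (hK : ∀ (f : P →ₗ[A] N), ∀ x ∈ K, f x = 0) :
    Module.rank k (Abelian.Ext (ModuleCat.of A (P ⧸ K)) (ModuleCat.of A N) 1) =
      Module.rank k (K →ₗ[A] N) := by
  let C : ShortComplex (ModuleCat.{u} A) := ShortComplex.mk
    (ModuleCat.ofHom K.subtype) (ModuleCat.ofHom K.mkQ) (by
      ext x
      exact (Submodule.Quotient.mk_eq_zero K).2 x.2)
  have hC : C.ShortExact :=
    { exact := by
        rw [ShortComplex.ShortExact.moduleCat_exact_iff_function_exact]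
        exact LinearMap.exact_subtype_mkQ K
      mono_f := (ModuleCat.mono_iff_injective _).2 K.injective_subtype
      epi_g := (ModuleCat.epi_iff_surjective _).2 K.mkQ_surjective }
  have : Projective C.X₂ := (IsProjective.iff_projective P).1 inferInstance
  let D : (K →ₗ[A] N) →ₗ[k] Abelian.Ext (ModuleCat.of A K) (ModuleCat.of A N) 0 :=
    { toFun := fun f => Abelian.Ext.mk₀ (ModuleCat.ofHom f)
      map_add' := fun f g => by
        rw [← Abelian.Ext.mk₀_add]
        rfl
      map_smul' := fun c f => by
        rw [RingHom.id_apply, ← Abelian.Ext.mk₀_smul]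
        congr 1
        ext x
        -- Scalars act on morphisms of `ModuleCat` through `algebraMap k A`, but on `K →ₗ[A] N`
        -- through the given structure of `N`; the scalar tower identifies the two.
        exact (algebraMap_smul A c (f x)).symm }
  have hD : Function.Bijective D := by
    constructor
    · intro f g h
      exact congrArg ModuleCat.Hom.hom ((Abelian.Ext.mk₀_bijective _ _).1 h)
    · intro x
      obtain ⟨f, rfl⟩ := (Abelian.Ext.mk₀_bijective _ _).2 x
      exact ⟨f.hom, rfl⟩
  let E : Abelian.Ext (ModuleCat.of A K) (ModuleCat.of A N) 0 →ₗ[k]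
      Abelian.Ext (ModuleCat.of A (P ⧸ K)) (ModuleCat.of A N) 1 :=
    Abelian.Ext.precompOfLinear hC.extClass k (ModuleCat.of A N) (add_zero 1)
  have hE : Function.Bijective E := by
    constructor
    · rw [← LinearMap.ker_eq_bot, LinearMap.ker_eq_bot']
      -- A class killed by the connecting map extends to a homomorphism `P → N`, and its restriction
      -- to `K` is zero by `hK`.
      intro x hx
      obtain ⟨y, hy⟩ := Abelian.Ext.contravariant_sequence_exact₁ hC (ModuleCat.of A N) x
        (add_zero 1) hx
      obtain ⟨f, rfl⟩ := (Abelian.Ext.mk₀_bijective _ _).2 y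
      rw [← hy, Abelian.Ext.mk₀_comp_mk₀]
      rw [show C.f ≫ f = 0 from ?_, Abelian.Ext.mk₀_zero]
      ext x
      exact hK f.hom x.1 x.2
    · intro x
      exact Abelian.Ext.contravariant_sequence_exact₃ hC (ModuleCat.of A N) x
        (Abelian.Ext.eq_zero_of_projective _) (add_zero 1)
  exact (LinearEquiv.ofBijective (E ∘ₗ D) (hE.comp hD)).rank_eq.symm

end Homological

/-! ### Multiplicities as dimensions of homomorphism spaces -/

section Multiplicity

variable {k : Type*} [Field k] {R : Type*} [Ring R] [Algebra k R]
  {V : Type*} [AddCommGroup V] [Module k V] [Module R V] [IsScalarTower k R V]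

theorem finite_hom (N : Type*) [AddCommGroup N] [Module k N] [Module R N] [IsScalarTower k R N]
    [FiniteDimensional k N] [FiniteDimensional k V] : FiniteDimensional k (N →ₗ[R] V) :=
  FiniteDimensional.of_injective (LinearMap.restrictScalarsₗ k R N V k)
    (LinearMap.restrictScalars_injective k)

open Classical in
-- Schur's lemma: a nonzero map between simple modules is invertible, and the endomorphisms of `V`
-- are scalars because `k` is algebraically closed.
theorem finrank_hom_of_isSimpleModule [IsAlgClosed k] [FiniteDimensional k V]
    [IsSimpleModule R V] (N : Type*) [AddCommGroup N] [Module R N] [IsSimpleModule R N] :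
    Module.finrank k (N →ₗ[R] V) = if Nonempty (N ≃ₗ[R] V) then 1 else 0 := by
  split_ifs with h
  · obtain ⟨f⟩ := h
    rw [(LinearEquiv.congrLeft V k f).finrank_eq]
    have h := IsSimpleModule.algebraMap_end_bijective_of_isAlgClosed (A := R) (V := V) k
    rw [← Module.finrank_self k]
    exact (LinearEquiv.ofBijective (Algebra.linearMap k (Module.End R V)) h).finrank_eq.symm
  · have : Subsingleton (N →ₗ[R] V) := subsingleton_of_forall_eq 0 fun f => by
      rcases f.bijective_or_eq_zero with hf | hf
      · exact absurd ⟨LinearEquiv.ofBijective f hf⟩ h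
      · exact hf
    exact Module.finrank_zero_of_subsingleton

/-- By semisimplicity `A` has a complement `B`, with `N ≃ A × B` and `N ⧸ A ≃ B`. Additivity lets
the dimension be computed along a composition series. -/
theorem finrank_hom_eq_add [IsSemisimpleRing R] [FiniteDimensional k V]
    {N : Type*} [AddCommGroup N] [Module k N] [Module R N] [IsScalarTower k R N]
    [FiniteDimensional k N] (A : Submodule R N) :
    Module.finrank k (N →ₗ[R] V) =
      Module.finrank k (A →ₗ[R] V) + Module.finrank k ((N ⧸ A) →ₗ[R] V) := by
  obtain ⟨B, hB⟩ := exists_isCompl A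
  have : FiniteDimensional k A :=
    inferInstanceAs (FiniteDimensional k (A.restrictScalars k))
  have : FiniteDimensional k B :=
    inferInstanceAs (FiniteDimensional k (B.restrictScalars k))
  have := finite_hom (R := R) (V := V) (k := k) A
  have := finite_hom (R := R) (V := V) (k := k) B
  rw [← (LinearEquiv.congrLeft V k (A.prodEquivOfIsCompl B hB)).finrank_eq,
    ← (LinearMap.coprodEquiv k (R := R) (M := A) (M₂ := B) (M₃ := V)).finrank_eq,
    Module.finrank_prod,
    (LinearEquiv.congrLeft V k (A.quotientEquivOfIsCompl B hB)).finrank_eq]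

theorem eq_sum_of_succ_eq_add {n : ℕ} (a : Fin (n + 1) → ℕ) (c : Fin n → ℕ) (h0 : a 0 = 0)
    (h : ∀ i : Fin n, a i.succ = a i.castSucc + c i) : a (Fin.last n) = ∑ i, c i := by
  induction n with
  | zero => simpa using h0
  | succ n ih =>
    rw [Fin.sum_univ_castSucc, ← ih (fun i => a i.castSucc) (fun i => c i.castSucc) h0
      (fun i => h i.castSucc)]
    exact h (Fin.last n)

/-- Over a semisimple algebra, the multiplicity of `V` in `N` is the dimension
of `Hom(N, V)`. -/
theorem isCompositionMultiplicity_finrank_hom [IsAlgClosed k] [IsSemisimpleRing R]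
    [FiniteDimensional k V] [IsSimpleModule R V]
    (N : Type*) [AddCommGroup N] [Module k N] [Module R N] [IsScalarTower k R N]
    [FiniteDimensional k N] :
    IsCompositionMultiplicity R V N (Module.finrank k (N →ₗ[R] V)) := by
  classical
  constructor
  · have : IsNoetherian R N := isNoetherian_of_tower k inferInstance
    have : IsArtinian R N := isArtinian_of_tower k inferInstance
    exact isFiniteLength_iff_exists_compositionSeries.1
      (isFiniteLength_iff_isNoetherian_isArtinian.2 ⟨inferInstance, inferInstance⟩)
  · intro s h0 h1
    rw [Nat.card_eq_fintype_card, Fintype.card_subtype, Finset.card_filter]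
    have hfin : ∀ A : Submodule R N, FiniteDimensional k A := fun A =>
      inferInstanceAs (FiniteDimensional k (A.restrictScalars k))
    -- The dimension of `Hom(s i, V)` starts at `0` and grows at each step by `1` or `0`, according
    -- to whether the factor is isomorphic to `V`; the sum of the jumps telescopes.
    rw [← eq_sum_of_succ_eq_add (fun i => Module.finrank k (s i →ₗ[R] V))]
    · change Module.finrank k (s.last →ₗ[R] V) = _
      rw [h1]
      exact (LinearEquiv.congrLeft V k Submodule.topEquiv).finrank_eq
    · change Module.finrank k (s.head →ₗ[R] V) = _
      rw [h0]
      exact Module.finrank_zero_of_subsingleton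
    · intro i
      have hlt : s i.castSucc ⋖ s i.succ := s.step i
      have := hfin (s i.succ)
      have : IsSimpleModule R (s i.succ ⧸ (s i.castSucc).submoduleOf (s i.succ)) :=
        (covBy_iff_quot_is_simple hlt.le).1 hlt
      change Module.finrank k (s i.succ →ₗ[R] V) = Module.finrank k (s i.castSucc →ₗ[R] V) + _
      rw [finrank_hom_eq_add ((s i.castSucc).submoduleOf (s i.succ)),
        (LinearEquiv.congrLeft V k (Submodule.submoduleOfEquivOfLe hlt.le)).finrank_eq,
        finrank_hom_of_isSimpleModule
          (s i.succ ⧸ (s i.castSucc).submoduleOf (s i.succ))]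

end Multiplicity

/-! ## Right modules over monoid algebras -/

section RightAct

variable (k : Type*) [Field k] {S : Type*} [Monoid S]
  {T : Type*} [AddCommGroup T] [Module k T] [Module (MonoidAlgebra k S)ᵐᵒᵖ T]
  [IsScalarTower k (MonoidAlgebra k S)ᵐᵒᵖ T]
  {W : Type*} [AddCommGroup W] [Module k W] [Module (MonoidAlgebra k S)ᵐᵒᵖ W]
  [IsScalarTower k (MonoidAlgebra k S)ᵐᵒᵖ W]

/-- The action of `s ∈ S` on a right `kS`-module. -/
def rightAct (s : S) : T →ₗ[k] T where
  toFun t := op (MonoidAlgebra.single s (1 : k)) • t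
  map_add' := smul_add _
  map_smul' c t := smul_comm _ c t

theorem rightAct_def (s : S) (t : T) :
    rightAct k s t = op (MonoidAlgebra.single s (1 : k)) • t := rfl

theorem rightAct_one (t : T) : rightAct k (1 : S) t = t := by
  rw [rightAct_def, ← MonoidAlgebra.one_def, op_one, one_smul]

theorem rightAct_mul (s s' : S) (t : T) :
    rightAct k (s * s') t = rightAct k s' (rightAct k s t) := by
  rw [rightAct_def, rightAct_def, rightAct_def, smul_smul, ← op_mul,
    MonoidAlgebra.single_mul_single, mul_one]

theorem op_single_smul (s : S) (c : k) (t : T) :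
    op (MonoidAlgebra.single s c) • t = c • rightAct k s t := by
  rw [rightAct_def, ← smul_assoc, ← op_smul, MonoidAlgebra.smul_single, smul_eq_mul, mul_one]

theorem map_rightAct (f : T →ₗ[(MonoidAlgebra k S)ᵐᵒᵖ] W) (s : S) (t : T) :
    f (rightAct k s t) = rightAct k s (f t) :=
  f.map_smul _ t

variable {k}

theorem rightAct_mem (N : Submodule (MonoidAlgebra k S)ᵐᵒᵖ T) (s : S) {t : T} (ht : t ∈ N) :
    rightAct k s t ∈ N :=
  N.smul_mem _ ht

/-- A `k`-linear map commuting with the action of `S` is `kS`-linear. -/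
def linearMapOfRightAct (f : T →ₗ[k] W)
    (hf : ∀ (s : S) (t : T), f (rightAct k s t) = rightAct k s (f t)) :
    T →ₗ[(MonoidAlgebra k S)ᵐᵒᵖ] W where
  toFun := f
  map_add' := f.map_add
  map_smul' a t := by
    induction a using MulOpposite.rec' with | _ a => ?_
    induction a using MonoidAlgebra.induction_linear with
    | zero => simp only [op_zero, zero_smul, map_zero]
    | add a b ha hb =>
      simp only [RingHom.id_apply] at ha hb
      simp only [op_add, add_smul, map_add, ha, hb, RingHom.id_apply]
    | single s c => rw [op_single_smul, map_smul, hf, RingHom.id_apply, op_single_smul]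

/-- A subspace stable under the action of `S` is a `kS`-submodule. -/
def submoduleOfRightAct (N : Submodule k T)
    (hN : ∀ (s : S), ∀ t ∈ N, rightAct k s t ∈ N) :
    Submodule (MonoidAlgebra k S)ᵐᵒᵖ T where
  carrier := N
  add_mem' := N.add_mem
  zero_mem' := N.zero_mem
  smul_mem' a t ht := by
    induction a using MulOpposite.rec' with | _ a => ?_
    induction a using MonoidAlgebra.induction_linear with
    | zero => rw [op_zero, zero_smul]; exact N.zero_mem
    | add a b ha hb => rw [op_add, add_smul]; exact N.add_mem ha hb
    | single s c => rw [op_single_smul]; exact N.smul_mem c (hN s t ht)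

end RightAct

/-! ## Balanced tensor products -/

namespace BalancedTensor

section General

variable {k : Type u} [Field k] {B : Type*} [Ring B] {A : Type*} [Ring A] [Algebra k A]
    {U : Type*} [AddCommGroup U] [Module k U] [Module Bᵐᵒᵖ U]
    {M : Type*} [AddCommGroup M] [Module k M] [Module B M] [Module Aᵐᵒᵖ M]
    [IsScalarTower k Aᵐᵒᵖ M]

variable (k B A U M) in
/-- The relations defining the balanced tensor product. -/
abbrev relations : Submodule Aᵐᵒᵖ (M ⊗[k] U) :=
  Submodule.span Aᵐᵒᵖ
    {z : M ⊗[k] U | ∃ (u : U) (b : B) (m : M), z = m ⊗ₜ[k] (op b • u) - (b • m) ⊗ₜ[k] u}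

/-- The class of `m ⊗ u`. -/
def mk (m : M) : U →ₗ[k] BalancedTensor k (B := B) A U M where
  toFun u := Submodule.Quotient.mk (m ⊗ₜ[k] u)
  map_add' u v := by rw [TensorProduct.tmul_add, Submodule.Quotient.mk_add]
  map_smul' c u := by
    rw [TensorProduct.tmul_smul, Submodule.Quotient.mk_smul, RingHom.id_apply]

theorem mk_add (m n : M) (u : U) :
    (mk (m + n) u : BalancedTensor k (B := B) A U M) = mk m u + mk n u := by
  change Submodule.Quotient.mk _ = _
  rw [TensorProduct.add_tmul, Submodule.Quotient.mk_add]
  rfl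

theorem mk_smul (c : k) (m : M) (u : U) :
    (mk (c • m) u : BalancedTensor k (B := B) A U M) = c • mk m u := by
  change Submodule.Quotient.mk _ = _
  rw [← TensorProduct.smul_tmul', Submodule.Quotient.mk_smul]
  rfl

theorem mk_balanced (m : M) (b : B) (u : U) :
    (mk (b • m) u : BalancedTensor k (B := B) A U M) = mk m (op b • u) := by
  exact ((Submodule.Quotient.eq (relations k B A U M)).2
    (Submodule.subset_span ⟨u, b, m, rfl⟩)).symm

theorem smul_mk (a : Aᵐᵒᵖ) (m : M) (u : U) :
    a • (mk m u : BalancedTensor k (B := B) A U M) = mk (a • m) u := by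
  change a • (Submodule.Quotient.mk (m ⊗ₜ[k] u) : (M ⊗[k] U) ⧸ relations k B A U M) =
    Submodule.Quotient.mk ((a • m) ⊗ₜ[k] u)
  rw [← Submodule.Quotient.mk_smul, TensorProduct.smul_tmul']

/-- The map `m ⊗ u` as a bilinear map. -/
def mkBilin : M →ₗ[k] U →ₗ[k] BalancedTensor k (B := B) A U M where
  toFun := mk
  map_add' m n := LinearMap.ext (mk_add m n)
  map_smul' c m := LinearMap.ext (mk_smul c m)

@[elab_as_elim]
theorem induction {p : BalancedTensor k (B := B) A U M → Prop}
    (t : BalancedTensor k (B := B) A U M) (hz : p 0) (hadd : ∀ s t, p s → p t → p (s + t))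
    (hmk : ∀ m u, p (mk m u)) : p t := by
  obtain ⟨z, rfl⟩ := Submodule.Quotient.mk_surjective _ t
  induction z using TensorProduct.induction_on with
  | zero => exact hz
  | tmul m u => exact hmk m u
  | add x y hx hy => exact hadd _ _ hx hy

theorem finiteDimensional [FiniteDimensional k U] [FiniteDimensional k M] :
    FiniteDimensional k (BalancedTensor k (B := B) A U M) := by
  refine Module.Finite.of_surjective
    (TensorProduct.lift (mkBilin : M →ₗ[k] U →ₗ[k] BalancedTensor k (B := B) A U M)) ?_
  rw [← LinearMap.range_eq_top, eq_top_iff]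
  intro t _
  induction t using BalancedTensor.induction with
  | hz => exact Submodule.zero_mem _
  | hadd x y hx hy => exact Submodule.add_mem _ (hx trivial) (hy trivial)
  | hmk m u => exact ⟨m ⊗ₜ[k] u, TensorProduct.lift.tmul _ _⟩

variable [SMulCommClass B Aᵐᵒᵖ M] {W : Type*} [AddCommGroup W] [Module k W]

/-- The linear map out of `U ⊗_B M` given by a balanced bilinear map. -/
def lift (f : M →ₗ[k] U →ₗ[k] W) (hf : ∀ (m : M) (b : B) (u : U), f (b • m) u = f m (op b • u)) :
    BalancedTensor k (B := B) A U M →ₗ[k] W :=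
  Submodule.liftQ ((relations k B A U M).restrictScalars k)
    (TensorProduct.lift f) (by
      intro z hz
      rw [Submodule.restrictScalars_mem] at hz
      -- The relations span an `Aᵐᵒᵖ`-submodule while `f` is only `k`-linear, so the induction needs
      -- the vanishing on all translates `a • z`. On generators, `a` is moved past `b` by the
      -- commutation of the two actions.
      suffices h : ∀ a : Aᵐᵒᵖ, TensorProduct.lift f (a • z) = 0 by
        have := h 1
        rwa [one_smul] at this
      induction hz using Submodule.span_induction with
      | mem z hz =>
        obtain ⟨u, b, m, rfl⟩ := hz
        intro a
        rw [smul_sub, TensorProduct.smul_tmul', TensorProduct.smul_tmul', map_sub,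
          TensorProduct.lift.tmul, TensorProduct.lift.tmul, ← smul_comm b a m, hf, sub_self]
      | zero => intro a; rw [smul_zero, map_zero]
      | add x y _ _ hx hy => intro a; rw [smul_add, map_add, hx, hy, add_zero]
      | smul c x _ hx => intro a; rw [smul_smul, hx]) ∘ₗ
    (Submodule.Quotient.restrictScalarsEquiv k (relations k B A U M)).symm.toLinearMap

end General

section Monoid

variable {k : Type u} [Field k] {H : Type*} [Monoid H] {S : Type*} [Monoid S]
    {U : Type*} [AddCommGroup U] [Module k U] [Module (MonoidAlgebra k H)ᵐᵒᵖ U]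
    {M : Type*} [AddCommGroup M] [Module k M] [Module (MonoidAlgebra k H) M]
    [Module (MonoidAlgebra k S)ᵐᵒᵖ M] [IsScalarTower k (MonoidAlgebra k S)ᵐᵒᵖ M]

theorem rightAct_mk (s : S) (m : M) (u : U) :
    rightAct k s
      (mk m u : BalancedTensor k (B := MonoidAlgebra k H) (MonoidAlgebra k S) U M) =
      mk (rightAct k s m) u :=
  smul_mk _ _ _

/-- It suffices to check that a bilinear map is balanced on the elements of `H`. -/
theorem balanced_of_single [IsScalarTower k (MonoidAlgebra k H)ᵐᵒᵖ U]
    [IsScalarTower k (MonoidAlgebra k H) M] {W : Type*} [AddCommGroup W] [Module k W]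
    (f : M →ₗ[k] U →ₗ[k] W)
    (hf : ∀ m (h : H) u, f (MonoidAlgebra.single h (1 : k) • m) u = f m (rightAct k h u))
    (m : M) (b : MonoidAlgebra k H) (u : U) : f (b • m) u = f m (op b • u) := by
  induction b using MonoidAlgebra.induction_linear with
  | zero => simp only [op_zero, zero_smul, map_zero, LinearMap.zero_apply]
  | add a b ha hb => simp only [op_add, add_smul, map_add, LinearMap.add_apply, ha, hb]
  | single h c =>
    have hc : (MonoidAlgebra.single h c : MonoidAlgebra k H) =
        c • MonoidAlgebra.single h (1 : k) := by
      rw [MonoidAlgebra.smul_single, smul_eq_mul, mul_one]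
    rw [op_single_smul, LinearMap.map_smul (f m), ← hf, hc, smul_assoc,
      LinearMap.map_smul f, LinearMap.smul_apply]

end Monoid

end BalancedTensor

/-! ## Induced modules -/

section Bimodules

variable {k : Type*} [Field k] {H : Type*} [Monoid H] {S : Type*} [Monoid S]
    {M : Type*} [AddCommGroup M] [Module k M] [Module (MonoidAlgebra k H) M]
    [Module (MonoidAlgebra k S)ᵐᵒᵖ M]

/-- Two actions commute if the actions of the elements of the monoids commute. -/
theorem smulCommClass_of_single [IsScalarTower k (MonoidAlgebra k S)ᵐᵒᵖ M]
    [IsScalarTower k (MonoidAlgebra k H) M]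
    (h : ∀ (x : H) (s : S) (m : M), (MonoidAlgebra.single x (1 : k)) • rightAct k s m =
      rightAct k s ((MonoidAlgebra.single x (1 : k)) • m)) :
    SMulCommClass (MonoidAlgebra k H) (MonoidAlgebra k S)ᵐᵒᵖ M where
  smul_comm b a m := by
    induction b using MonoidAlgebra.induction_linear with
    | zero => simp only [zero_smul, smul_zero]
    | add b b' hb hb' => simp only [add_smul, smul_add, hb, hb']
    | single x c =>
      let f : M →ₗ[k] M :=
        { toFun := fun m => MonoidAlgebra.single x c • m
          map_add' := smul_add _
          map_smul' := fun d m => smul_comm _ d m }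
      refine (linearMapOfRightAct f ?_).map_smul a m
      intro s t
      change MonoidAlgebra.single x c • rightAct k s t =
        rightAct k s (MonoidAlgebra.single x c • t)
      have hc : (MonoidAlgebra.single x c : MonoidAlgebra k H) =
          c • MonoidAlgebra.single x (1 : k) := by
        rw [MonoidAlgebra.smul_single, smul_eq_mul, mul_one]
      rw [hc, smul_assoc, smul_assoc, map_smul, h]

end Bimodules

section KR

variable (k : Type u) [Field k] {S : Type u} [Monoid S] (e : Idem S)

instance : IsScalarTower k (MonoidAlgebra k (MaxSubgroup e)) (KR k e) where
  smul_assoc c a x := by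
    change MonoidAlgebra.lift k _ _ (KR.leftRep k e) (c • a) x =
      c • MonoidAlgebra.lift k _ _ (KR.leftRep k e) a x
    rw [map_smul, LinearMap.smul_apply]

variable {e}

/-- The left translation of an `R`-class by an element of the maximal subgroup. -/
def RClass.left (g : MaxSubgroup e) (x : RClass e) : RClass e :=
  ⟨g.toS * x.val, RClass.maxSubgroup_mul e g x⟩

theorem KR.single_smul (g : MaxSubgroup e) (x : RClass e) :
    (MonoidAlgebra.single g (1 : k)) • (Finsupp.single x 1 : KR k e) =
      Finsupp.single (x.left g) 1 := by
  change MonoidAlgebra.lift k _ _ (KR.leftRep k e) (MonoidAlgebra.single g 1) _ = _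
  rw [MonoidAlgebra.lift_single, one_smul]
  exact Finsupp.mapDomain_single

theorem KR.rightAct_single (s : S) (x : RClass e) :
    rightAct k s (Finsupp.single x 1 : KR k e) = KR.act k e s x := by
  change (MonoidAlgebra.lift k _ _ (KR.rightRep k e) (MonoidAlgebra.single s 1)).unop _ = _
  rw [MonoidAlgebra.lift_single, one_smul]
  change Finsupp.linearCombination k (KR.act k e s) (Finsupp.single x 1) = _
  rw [Finsupp.linearCombination_single, one_smul]

theorem RClass.left_mul (x : RClass e) : e.1 * x.val = x.val := by
  obtain ⟨a, ha⟩ := rightIdeal_subset_iff.1 x.mem.subset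
  rw [ha, ← mul_assoc, e.2.eq]

/-- Left multiplication by `g` permutes the `R`-class, with inverse left multiplication by `g⁻¹`.
Hence the left action respects the cut-off to zero in the right action, and the two actions on `kR`
commute. -/
theorem RClass.rightIdeal_left_mul_iff (g : MaxSubgroup e) (x : RClass e) (s : S) :
    rightIdeal ((x.left g).val * s) = rightIdeal e.1 ↔ rightIdeal (x.val * s) = rightIdeal e.1 := by
  constructor
  · intro h
    have := RClass.maxSubgroup_mul e g⁻¹ ⟨_, h⟩
    change rightIdeal (g⁻¹.toS * (g.toS * x.val * s)) = _ at this
    rwa [← mul_assoc, ← mul_assoc, g.inv_mul', x.left_mul] at this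
  · intro h
    have := RClass.maxSubgroup_mul e g ⟨_, h⟩
    rwa [← mul_assoc] at this

instance : SMulCommClass (MonoidAlgebra k (MaxSubgroup e)) (MonoidAlgebra k S)ᵐᵒᵖ (KR k e) :=
  smulCommClass_of_single (k := k) fun g s m => by
    induction m using Finsupp.induction_linear with
    | zero => simp only [map_zero, smul_zero]
    | add m n hm hn => simp only [map_add, smul_add, hm, hn]
    | single x c =>
      rw [← mul_one c, ← smul_eq_mul, ← Finsupp.smul_single, map_smul,
        smul_comm _ c, smul_comm _ c, map_smul, KR.single_smul, KR.rightAct_single,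
        KR.rightAct_single]
      congr 1
      by_cases h : rightIdeal (x.val * s) = rightIdeal e.1
      · rw [KR.act, KR.act, dif_pos h, dif_pos ((RClass.rightIdeal_left_mul_iff g x s).2 h),
          KR.single_smul]
        congr 1
        exact RClass.ext (mul_assoc _ _ _).symm
      · rw [KR.act, KR.act, dif_neg h,
          dif_neg (fun h' => h ((RClass.rightIdeal_left_mul_iff g x s).1 h')), smul_zero]

end KR

/-! ### Elementary tensors and the universal property of `Ind` -/

section Ind

variable (k : Type u) [Field k] {S : Type u} [Monoid S] {e : Idem S}
  {U : Type u} [AddCommGroup U] [Module k U] [Module (MonoidAlgebra k (MaxSubgroup e))ᵐᵒᵖ U]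

/-- The element `u ⊗ x` of the induced module. -/
def Ind.tmul (x : RClass e) : U →ₗ[k] Ind k e U :=
  BalancedTensor.mk (Finsupp.single x 1)

variable {k}

@[elab_as_elim]
theorem Ind.induction {p : Ind k e U → Prop} (t : Ind k e U) (hz : p 0)
    (hadd : ∀ s t, p s → p t → p (s + t)) (hmk : ∀ x u, p (Ind.tmul k x u)) : p t := by
  induction t using BalancedTensor.induction with
  | hz => exact hz
  | hadd s t hs ht => exact hadd s t hs ht
  | hmk m u =>
    induction m using Finsupp.induction_linear with
    | zero =>
      rw [← zero_smul k 0, BalancedTensor.mk_smul, zero_smul]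
      exact hz
    | add m n hm hn => rw [BalancedTensor.mk_add]; exact hadd _ _ hm hn
    | single x c =>
      rw [← mul_one c, ← smul_eq_mul, ← Finsupp.smul_single, BalancedTensor.mk_smul,
        ← map_smul]
      exact hmk x _

theorem Ind.linearMap_ext {W : Type*} [AddCommGroup W] [Module k W] {f g : Ind k e U →ₗ[k] W}
    (h : ∀ x u, f (Ind.tmul k x u) = g (Ind.tmul k x u)) : f = g := by
  refine LinearMap.ext fun t => ?_
  induction t using Ind.induction with
  | hz => rw [map_zero, map_zero]
  | hadd s t hs ht => rw [map_add, map_add, hs, ht]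
  | hmk x u => exact h x u

theorem Ind.rightAct_tmul (s : S) (x : RClass e) (u : U)
    (h : rightIdeal (x.val * s) = rightIdeal e.1) :
    rightAct k s (Ind.tmul k x u) = Ind.tmul k ⟨x.val * s, h⟩ u := by
  rw [Ind.tmul, BalancedTensor.rightAct_mk, KR.rightAct_single, KR.act, dif_pos h]
  rfl

theorem Ind.rightAct_tmul_eq_zero (s : S) (x : RClass e) (u : U)
    (h : ¬ rightIdeal (x.val * s) = rightIdeal e.1) :
    rightAct k s (Ind.tmul k x u) = 0 := by
  rw [Ind.tmul, BalancedTensor.rightAct_mk, KR.rightAct_single, KR.act, dif_neg h,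
    ← zero_smul k 0, BalancedTensor.mk_smul, zero_smul]

variable [IsScalarTower k (MonoidAlgebra k (MaxSubgroup e))ᵐᵒᵖ U]

theorem Ind.tmul_left (g : MaxSubgroup e) (x : RClass e) (u : U) :
    Ind.tmul k (x.left g) u = Ind.tmul k x (rightAct k g u) := by
  rw [Ind.tmul, ← KR.single_smul, BalancedTensor.mk_balanced]
  rfl

/-- The linear map out of `U ⊗ kR` given by a balanced family of linear maps. -/
def Ind.lift {W : Type*} [AddCommGroup W] [Module k W] (f : RClass e → U →ₗ[k] W)
    (hf : ∀ g x u, f (x.left g) u = f x (rightAct k g u)) : Ind k e U →ₗ[k] W :=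
  BalancedTensor.lift (Finsupp.linearCombination k f) (by
    refine BalancedTensor.balanced_of_single _ fun m g u => ?_
    induction m using Finsupp.induction_linear with
    | zero => simp only [map_zero, smul_zero, LinearMap.zero_apply]
    | add m n hm hn => simp only [map_add, smul_add, LinearMap.add_apply, hm, hn]
    | single x c =>
      rw [← mul_one c, ← smul_eq_mul, ← Finsupp.smul_single, smul_comm _ c, KR.single_smul,
        map_smul, map_smul, Finsupp.linearCombination_single,
        Finsupp.linearCombination_single, one_smul, one_smul, LinearMap.smul_apply, hf]
      rfl)

@[simp]
theorem Ind.lift_tmul {W : Type*} [AddCommGroup W] [Module k W] (f : RClass e → U →ₗ[k] W)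
    (hf : ∀ g x u, f (x.left g) u = f x (rightAct k g u)) (x : RClass e) (u : U) :
    Ind.lift f hf (Ind.tmul k x u) = f x u := by
  change Finsupp.linearCombination k f (Finsupp.single x 1) u = _
  rw [Finsupp.linearCombination_single, one_smul]

end Ind

/-! ## Simple modules whose apex is the group of units -/

section Units

variable {S : Type u} [Monoid S]

theorem isUnit_toS (g : MaxSubgroup (oneIdem S)) : IsUnit g.toS :=
  isUnit_of_inverses g.mul_inv' g.inv_mul'

theorem exists_toS_eq {s : S} (hs : IsUnit s) : ∃ g : MaxSubgroup (oneIdem S), g.toS = s := by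
  obtain ⟨u, rfl⟩ := hs
  exact ⟨⟨⟨u, u, by simp [oneIdem]⟩, ⟨↑u⁻¹, ↑u⁻¹, by simp [oneIdem]⟩,
    LocalMonoid.ext u.mul_inv, LocalMonoid.ext u.inv_mul⟩, rfl⟩

variable [Finite S]

/-- Left multiplication by `t` is injective, hence surjective on the finite set `S`, so `t` also has
a right inverse, which must be `s`. -/
theorem isUnit_of_mul_eq_one_of_finite {s t : S} (h : s * t = 1) : IsUnit s := by
  have hinj : Function.Injective (fun x : S => t * x) := fun x y hxy => by
    have := congrArg (s * ·) hxy
    simpa only [← mul_assoc, h, one_mul] using this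
  obtain ⟨x, hx⟩ := (Finite.injective_iff_surjective.1 hinj) 1
  change t * x = 1 at hx
  have : x = s := by rw [← one_mul x, ← h, mul_assoc, hx, mul_one]
  exact isUnit_of_inverses h (this ▸ hx)

theorem rightIdeal_eq_one_iff {s : S} : rightIdeal s = rightIdeal (oneIdem S).1 ↔ IsUnit s := by
  constructor
  · intro h
    obtain ⟨a, ha⟩ := rightIdeal_subset_iff.1 h.symm.subset
    exact isUnit_of_mul_eq_one_of_finite ha.symm
  · rintro ⟨u, rfl⟩
    apply subset_antisymm
    · exact rightIdeal_subset_iff.2 ⟨u, (one_mul _).symm⟩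
    · exact rightIdeal_subset_iff.2 ⟨((u⁻¹ : Sˣ) : S), u.mul_inv.symm⟩

/-- An element of the `R`-class of the identity as an element of the group of units. -/
def RClass.toUnit (x : RClass (oneIdem S)) : MaxSubgroup (oneIdem S) :=
  (exists_toS_eq (rightIdeal_eq_one_iff.1 x.mem)).choose

theorem RClass.toUnit_toS (x : RClass (oneIdem S)) : x.toUnit.toS = x.val :=
  (exists_toS_eq (rightIdeal_eq_one_iff.1 x.mem)).choose_spec

variable {k : Type u} [Field k] (V : Type u) [AddCommGroup V] [Module k V]
  [Module (MonoidAlgebra k (MaxSubgroup (oneIdem S)))ᵐᵒᵖ V]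
  [IsScalarTower k (MonoidAlgebra k (MaxSubgroup (oneIdem S)))ᵐᵒᵖ V]

/-- The identity as an element of its `R`-class. -/
def RClass.one : RClass (oneIdem S) := ⟨1, rfl⟩

variable (k S) in
/-- The canonical map `Ind(V) → V` at the identity. -/
def Ind.toSelf : Ind k (oneIdem S) V →ₗ[k] V :=
  Ind.lift (fun x => rightAct k x.toUnit) fun g x v => by
    have : (x.left g).toUnit = g * x.toUnit := by
      apply MaxSubgroup.toS_injective
      rw [RClass.toUnit_toS, MaxSubgroup.toS_mul, RClass.toUnit_toS]
      rfl
    rw [this, rightAct_mul]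

/-- The `R`-class of the identity is the group of units, so `x = x · 1` and the unit `x` can be
moved across the tensor sign. -/
theorem Ind.tmul_eq_tmul_one (x : RClass (oneIdem S)) (v : V) :
    Ind.tmul k x v = Ind.tmul k RClass.one (rightAct k x.toUnit v) := by
  rw [← Ind.tmul_left]
  congr 2
  refine RClass.ext ?_
  change x.val = x.toUnit.toS * 1
  rw [mul_one, RClass.toUnit_toS]

variable (k S) in
/-- The induced module at the identity is the module itself. -/
def Ind.equivSelf : V ≃ₗ[k] Ind k (oneIdem S) V :=
  LinearEquiv.ofLinearMap (Ind.tmul k RClass.one) (Ind.toSelf S k V)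
    (Ind.linearMap_ext fun x v => by
      change Ind.tmul k RClass.one (Ind.toSelf S k V (Ind.tmul k x v)) = Ind.tmul k x v
      rw [Ind.toSelf, Ind.lift_tmul, ← Ind.tmul_eq_tmul_one])
    (LinearMap.ext fun v => by
      change Ind.toSelf S k V (Ind.tmul k RClass.one v) = v
      rw [Ind.toSelf, Ind.lift_tmul]
      have : (RClass.one : RClass (oneIdem S)).toUnit = 1 :=
        MaxSubgroup.toS_injective (RClass.toUnit_toS _)
      rw [this, rightAct_one])

theorem Ind.equivSelf_rightAct (g : MaxSubgroup (oneIdem S)) (v : V) :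
    Ind.equivSelf S k V (rightAct k g v) = rightAct k g.toS (Ind.equivSelf S k V v) := by
  change Ind.tmul k RClass.one (rightAct k g v) = rightAct k g.toS (Ind.tmul k RClass.one v)
  have h : rightIdeal ((RClass.one : RClass (oneIdem S)).val * g.toS) =
      rightIdeal (oneIdem S).1 := by
    change rightIdeal (1 * g.toS) = _
    rw [one_mul]
    exact rightIdeal_eq_one_iff.2 (isUnit_toS g)
  rw [Ind.rightAct_tmul g.toS RClass.one v h, ← Ind.tmul_left]
  congr 2
  refine RClass.ext ?_
  change g.toS * 1 = 1 * g.toS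
  rw [one_mul, mul_one]

theorem Ind.rightAct_equivSelf_of_not_isUnit {s : S} (hs : ¬ IsUnit s) (v : V) :
    rightAct k s (Ind.equivSelf S k V v) = 0 :=
  Ind.rightAct_tmul_eq_zero s RClass.one v fun h => hs <| by
    change rightIdeal (1 * s) = _ at h
    rw [one_mul] at h
    exact rightIdeal_eq_one_iff.1 h

variable [IsSimpleModule (MonoidAlgebra k (MaxSubgroup (oneIdem S)))ᵐᵒᵖ V]

/-- Under `Ind.equivSelf` a `kS`-submodule pulls back to a `kG`-submodule of the simple module `V`.
-/
theorem Ind.isSimpleModule_one :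
    IsSimpleModule (MonoidAlgebra k S)ᵐᵒᵖ (Ind k (oneIdem S) V) := by
  have : Nontrivial V :=
    IsSimpleModule.nontrivial (MonoidAlgebra k (MaxSubgroup (oneIdem S)))ᵐᵒᵖ V
  have : Nontrivial (Ind k (oneIdem S) V) := (Ind.equivSelf S k V).injective.nontrivial
  refine { eq_bot_or_eq_top := fun N => ?_ }
  let N' : Submodule (MonoidAlgebra k (MaxSubgroup (oneIdem S)))ᵐᵒᵖ V :=
    submoduleOfRightAct ((N.restrictScalars k).comap (Ind.equivSelf S k V).toLinearMap)
      fun g v hv => by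
        change Ind.equivSelf S k V (rightAct k g v) ∈ N
        rw [Ind.equivSelf_rightAct]
        exact rightAct_mem N _ hv
  have hN' : ∀ v, v ∈ N' ↔ Ind.equivSelf S k V v ∈ N := fun v => Iff.rfl
  rcases eq_bot_or_eq_top N' with h | h
  · refine Or.inl ((Submodule.eq_bot_iff _).2 fun t ht => ?_)
    obtain ⟨v, rfl⟩ := (Ind.equivSelf S k V).surjective t
    rw [← hN', h, Submodule.mem_bot] at ht
    rw [ht, map_zero]
  · refine Or.inr (eq_top_iff.2 fun t _ => ?_)
    obtain ⟨v, rfl⟩ := (Ind.equivSelf S k V).surjective t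
    rw [← hN', h]
    trivial

/-- The simple `kS`-module whose apex is the group of units is `V`, with the non-units
acting as zero. -/
theorem exists_equiv_tilde_one :
    ∃ j : V ≃ₗ[k] Tilde k (oneIdem S) V,
      (∀ (g : MaxSubgroup (oneIdem S)) (v : V),
        j (rightAct k g v) = rightAct k g.toS (j v)) ∧
      ∀ (s : S), ¬ IsUnit s → ∀ v : V, rightAct k s (j v) = 0 := by
  have := Ind.isSimpleModule_one (k := k) (S := S) V
  have hbot : Module.jacobson (MonoidAlgebra k S)ᵐᵒᵖ (Ind k (oneIdem S) V) = ⊥ :=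
    IsSimpleModule.jacobson_eq_bot _ _
  let q := (Submodule.quotEquivOfEqBot _ hbot).symm
  refine ⟨(Ind.equivSelf S k V).trans (q.restrictScalars k), fun g v => ?_, fun s hs v => ?_⟩
  · change q (Ind.equivSelf S k V (rightAct k g v)) =
      rightAct k g.toS (q (Ind.equivSelf S k V v))
    rw [Ind.equivSelf_rightAct]
    exact map_rightAct k q.toLinearMap _ _
  · change rightAct k s (q (Ind.equivSelf S k V v)) = 0
    refine (map_rightAct k q.toLinearMap _ _).symm.trans ?_
    rw [Ind.rightAct_equivSelf_of_not_isUnit V hs, map_zero]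

end Units

/-! ## Induced modules whose apex is the minimal ideal -/

section MinimalIdeal

variable {k : Type u} [Field k] {S : Type u} [Monoid S]

instance [Finite S] (e : Idem S) : Finite (MaxSubgroup e) :=
  Finite.of_injective _ MaxSubgroup.toS_injective

/-- Right translation on the minimal ideal. -/
def minMul (x : minimalIdeal S) (s : S) : minimalIdeal S :=
  ⟨x.1 * s, minimalIdeal_mul_right x.2 s⟩

/-- Left translation on the minimal ideal. -/
def mulMin (s : S) (x : minimalIdeal S) : minimalIdeal S :=
  ⟨s * x.1, minimalIdeal_mul_left x.2 s⟩

/-- The idempotent of the minimal ideal as an element of the minimal ideal. -/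
def MinIdem.elt (e : MinIdem S) : minimalIdeal S := ⟨e.1.1, e.2⟩

variable [IsRRBG S] (e : MinIdem S)

/-- For `x` in `J`, minimality gives `e = axb`, and `ax` lies in `xS`, so `e` lies in `xS`;
conversely `x = ex`. -/
theorem rightIdeal_eq_iff_mem {x : S} :
    rightIdeal x = rightIdeal e.1.1 ↔ x ∈ minimalIdeal S := by
  constructor
  · intro h
    obtain ⟨a, rfl⟩ := rightIdeal_subset_iff.1 h.subset
    exact minimalIdeal_mul_right e.2 a
  · intro hx
    apply subset_antisymm
    · exact rightIdeal_subset_iff.2 ⟨x, (minIdem_mul e ⟨x, hx⟩).symm⟩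
    · obtain ⟨a, b, hab⟩ := JLE_iff.1 (e.2 x)
      obtain ⟨c, hc⟩ := IsRRBG.exists_mul a x
      exact rightIdeal_subset_iff.2 ⟨c * b, by rw [hab, hc, mul_assoc]⟩

/-- The minimal ideal is the `R`-class of each of its idempotents. -/
def minToRClass (x : minimalIdeal S) : RClass e.1 := ⟨x.1, (rightIdeal_eq_iff_mem e).2 x.2⟩

/-- The element `xe` of the maximal subgroup at `e`. -/
def minToH (x : minimalIdeal S) : MaxSubgroup e.1 := X.toH e ⟦x⟧

theorem minToH_toS (x : minimalIdeal S) : (minToH e x).toS = x.1 * e.1.1 := X.toH_mk e x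

theorem minToH_mulMin (h : MaxSubgroup e.1) (x : minimalIdeal S) :
    minToH e (mulMin h.toS x) = h * minToH e x := by
  apply MaxSubgroup.toS_injective
  rw [MaxSubgroup.toS_mul, minToH_toS, minToH_toS, ← mul_assoc]
  rfl

theorem minToH_elt : minToH e e.elt = 1 := by
  apply MaxSubgroup.toS_injective
  rw [minToH_toS]
  exact e.1.2

theorem minMul_idem (x : minimalIdeal S) : minMul x e.1.1 = mulMin (minToH e x).toS e.elt := by
  apply Subtype.ext
  change x.1 * e.1.1 = (minToH e x).toS * e.1.1
  rw [MaxSubgroup.right, minToH_toS]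

variable {U : Type u} [AddCommGroup U] [Module k U] [Module (MonoidAlgebra k (MaxSubgroup e.1))ᵐᵒᵖ U]

variable (k) in
/-- The element `u ⊗ x` of the induced module, for `x` in the minimal ideal. -/
def minTmul (x : minimalIdeal S) : U →ₗ[k] Ind k e.1 U := Ind.tmul k (minToRClass e x)

theorem minTmul_induction {p : Ind k e.1 U → Prop} (t : Ind k e.1 U) (hz : p 0)
    (hadd : ∀ s t, p s → p t → p (s + t)) (hmk : ∀ x u, p (minTmul k e x u)) : p t :=
  Ind.induction t hz hadd fun x u => hmk ⟨x.val, (rightIdeal_eq_iff_mem e).1 x.mem⟩ u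

theorem minTmul_ext {W : Type*} [AddCommGroup W] [Module k W] {f g : Ind k e.1 U →ₗ[k] W}
    (h : ∀ x u, f (minTmul k e x u) = g (minTmul k e x u)) : f = g :=
  Ind.linearMap_ext fun x u => h ⟨x.val, (rightIdeal_eq_iff_mem e).1 x.mem⟩ u

theorem rightAct_minTmul (s : S) (x : minimalIdeal S) (u : U) :
    rightAct k s (minTmul k e x u) = minTmul k e (minMul x s) u :=
  Ind.rightAct_tmul s (minToRClass e x) u ((rightIdeal_eq_iff_mem e).2 (minMul x s).2)

/-- Since `ex = x`, the tensors `u ⊗ e` generate the induced module. -/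
theorem rightAct_elt_minTmul (x : minimalIdeal S) (u : U) :
    rightAct k x.1 (minTmul k e e.elt u) = minTmul k e x u := by
  rw [rightAct_minTmul]
  congr 2
  exact Subtype.ext (minIdem_mul e x)

variable (k U) in
/-- The submodule of the induced module annihilated by `e`. -/
def indKer : Submodule (MonoidAlgebra k S)ᵐᵒᵖ (Ind k e.1 U) :=
  submoduleOfRightAct (LinearMap.ker (rightAct k e.1.1)) fun s t ht => by
    rw [LinearMap.mem_ker] at ht ⊢
    -- Stability rests on `se = ese`: if `te = 0`, then `(ts)e = (te)(se) = 0`.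
    rw [← rightAct_mul, ← IsRRBG.idem_mul, rightAct_mul, ht, map_zero]

theorem mem_indKer {t : Ind k e.1 U} : t ∈ indKer k e U ↔ rightAct k e.1.1 t = 0 := Iff.rfl

theorem sub_rightAct_idem_mem (t : Ind k e.1 U) : t - rightAct k e.1.1 t ∈ indKer k e U := by
  rw [mem_indKer, map_sub, ← rightAct_mul, e.1.2.eq, sub_self]

theorem eq_top_of_minTmul_elt_mem {N : Submodule (MonoidAlgebra k S)ᵐᵒᵖ (Ind k e.1 U)}
    (h : ∀ u, minTmul k e e.elt u ∈ N) : N = ⊤ := by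
  refine eq_top_iff.2 fun t _ => ?_
  induction t using minTmul_induction with
  | hz => exact N.zero_mem
  | hadd s t hs ht => exact N.add_mem (hs trivial) (ht trivial)
  | hmk x u =>
    rw [← rightAct_elt_minTmul]
    exact rightAct_mem N _ (h u)

variable [IsScalarTower k (MonoidAlgebra k (MaxSubgroup e.1))ᵐᵒᵖ U]

theorem minTmul_mulMin (h : MaxSubgroup e.1) (x : minimalIdeal S) (u : U) :
    minTmul k e (mulMin h.toS x) u = minTmul k e x (rightAct k h u) :=
  Ind.tmul_left h (minToRClass e x) u

/-- The linear map out of the induced module given by a balanced family of linear maps. -/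
def minLift {W : Type*} [AddCommGroup W] [Module k W] (f : minimalIdeal S → U →ₗ[k] W)
    (hf : ∀ (g : MaxSubgroup e.1) x u, f (mulMin g.toS x) u = f x (rightAct k g u)) :
    Ind k e.1 U →ₗ[k] W :=
  Ind.lift (fun x => f ⟨x.val, (rightIdeal_eq_iff_mem e).1 x.mem⟩) fun g x u =>
    hf g ⟨x.val, (rightIdeal_eq_iff_mem e).1 x.mem⟩ u

@[simp]
theorem minLift_minTmul {W : Type*} [AddCommGroup W] [Module k W]
    (f : minimalIdeal S → U →ₗ[k] W)
    (hf : ∀ (g : MaxSubgroup e.1) x u, f (mulMin g.toS x) u = f x (rightAct k g u))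
    (x : minimalIdeal S) (u : U) : minLift e f hf (minTmul k e x u) = f x u :=
  Ind.lift_tmul _ _ _ _

theorem minTmul_minMul_idem (x : minimalIdeal S) (u : U) :
    minTmul k e (minMul x e.1.1) u = minTmul k e e.elt (rightAct k (minToH e x) u) := by
  rw [minMul_idem, minTmul_mulMin]

variable (k U) in
/-- The canonical map `Ind(U) → U`, `u ⊗ x ↦ u(xe)`. -/
def aug : Ind k e.1 U →ₗ[k] U :=
  minLift e (fun x => rightAct k (minToH e x)) fun g x u => by
    rw [minToH_mulMin, rightAct_mul]

/-- Since `xe` lies in `H`, it passes across the tensor: `u ⊗ xe = u(xe) ⊗ e`. So the action of `e`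
is the projection of the induced module onto the copy `U ⊗ e` of `U`. -/
theorem rightAct_idem (t : Ind k e.1 U) :
    rightAct k e.1.1 t = minTmul k e e.elt (aug k e U t) := by
  have : rightAct k e.1.1 = minTmul k e e.elt ∘ₗ aug k e U := by
    refine minTmul_ext e fun x u => ?_
    rw [rightAct_minTmul, minTmul_minMul_idem, LinearMap.comp_apply, aug, minLift_minTmul]
  rw [this, LinearMap.comp_apply]

theorem aug_elt (u : U) : aug k e U (minTmul k e e.elt u) = u := by
  rw [aug, minLift_minTmul, minToH_elt, rightAct_one]

/-! ### Projectivity by averaging over `H` -/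

section Projective

variable [Finite S]

open Classical in
/-- Averaging over `H`, a lift of the map `u ↦ u ⊗ e` along a surjection can be chosen
equivariant. -/
theorem exists_equivariant_lift (hH : (Nat.card (MaxSubgroup e.1) : k) ≠ 0)
    {F : Type*} [AddCommGroup F] [Module k F] [Module (MonoidAlgebra k S)ᵐᵒᵖ F]
    [IsScalarTower k (MonoidAlgebra k S)ᵐᵒᵖ F]
    (f : F →ₗ[(MonoidAlgebra k S)ᵐᵒᵖ] Ind k e.1 U) (hf : Function.Surjective f) :
    ∃ σ : U →ₗ[k] F, (∀ u, f (σ u) = minTmul k e e.elt u) ∧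
      ∀ (g : MaxSubgroup e.1) u, σ (rightAct k g u) = rightAct k g.toS (σ u) := by
  let _ : Fintype (MaxSubgroup e.1) := Fintype.ofFinite _
  obtain ⟨r, hr⟩ := (f.restrictScalars k).exists_rightInverse_of_surjective
    (LinearMap.range_eq_top.2 hf)
  have hr' : ∀ t, f (r t) = t := fun t => LinearMap.congr_fun hr t
  -- The sum over `h` of `r` conjugated by `h`. Each summand still lifts `u ⊗ e`, so `τ` is `|H|`
  -- times a lift and has to be divided by `|H|`.
  let τ : U →ₗ[k] F := ∑ h : MaxSubgroup e.1,
    rightAct k h.toS ∘ₗ r ∘ₗ minTmul k e e.elt ∘ₗ rightAct k h⁻¹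
  have hτ : ∀ u, τ u = ∑ h : MaxSubgroup e.1,
      rightAct k h.toS (r (minTmul k e e.elt (rightAct k h⁻¹ u))) := fun u => by
    simp only [τ, LinearMap.sum_apply, LinearMap.comp_apply]
  refine ⟨(Nat.card (MaxSubgroup e.1) : k)⁻¹ • τ, fun u => ?_, fun g u => ?_⟩
  · have hsum : f (τ u) = (Nat.card (MaxSubgroup e.1) : k) • minTmul k e e.elt u := by
      rw [hτ, map_sum, Nat.card_eq_fintype_card, Nat.cast_smul_eq_nsmul, ← Finset.card_univ]
      refine Finset.sum_eq_card_nsmul fun h _ => ?_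
      -- Both sides are `h`, because `e` is the identity of `H`; this turns right multiplication of
      -- `u ⊗ e` by `h` into the action of `h` on `u`.
      have hcomm : minMul e.elt h.toS = mulMin h.toS e.elt :=
        Subtype.ext (h.left.trans h.right.symm)
      rw [map_rightAct, hr', rightAct_minTmul, hcomm, minTmul_mulMin, ← rightAct_mul,
        inv_mul_cancel, rightAct_one]
    rw [LinearMap.smul_apply]
    refine ((f.restrictScalars k).map_smul _ _).trans ?_
    change _ • f (τ u) = _
    rw [hsum, smul_smul, inv_mul_cancel₀ hH, one_smul]
  · rw [LinearMap.smul_apply, LinearMap.smul_apply, map_smul, hτ, hτ, map_sum]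
    congr 1
    refine Fintype.sum_equiv (Equiv.mulRight g⁻¹) _ _ fun h => ?_
    rw [Equiv.coe_mulRight, ← rightAct_mul, ← rightAct_mul, mul_inv_rev, inv_inv,
      ← MaxSubgroup.toS_mul, inv_mul_cancel_right]

/-- The modules induced from the minimal ideal are projective. -/
theorem projective_ind_min (hH : (Nat.card (MaxSubgroup e.1) : k) ≠ 0) :
    Module.Projective (MonoidAlgebra k S)ᵐᵒᵖ (Ind k e.1 U) := by
  refine Module.Projective.of_lifting_property'' fun f hf => ?_
  obtain ⟨σ, hσ, hσ'⟩ := exists_equivariant_lift e hH f hf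
  -- The section is `u ⊗ x ↦ σ(u)x`; equivariance of `σ` is exactly what makes it balanced over `H`.
  let g : Ind k e.1 U →ₗ[k] (Ind k e.1 U →₀ (MonoidAlgebra k S)ᵐᵒᵖ) :=
    minLift e (fun x => rightAct k x.1 ∘ₗ σ) fun h x u => by
      rw [LinearMap.comp_apply, LinearMap.comp_apply, hσ', ← rightAct_mul]
      rfl
  have hg : ∀ x u, g (minTmul k e x u) = rightAct k x.1 (σ u) := fun x u =>
    minLift_minTmul e _ _ x u
  have hg' : ∀ (s : S) t, g (rightAct k s t) = rightAct k s (g t) := fun s t => by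
    have : g ∘ₗ rightAct k s = rightAct k s ∘ₗ g := minTmul_ext e fun x u => by
      rw [LinearMap.comp_apply, LinearMap.comp_apply, rightAct_minTmul, hg, hg, ← rightAct_mul]
      rfl
    exact LinearMap.congr_fun this t
  refine ⟨linearMapOfRightAct g hg', LinearMap.ext fun t => ?_⟩
  have : f.restrictScalars k ∘ₗ g = LinearMap.id := minTmul_ext e fun x u => by
    change f (g (minTmul k e x u)) = minTmul k e x u
    rw [hg, map_rightAct, hσ, rightAct_elt_minTmul]
  exact LinearMap.congr_fun this t

end Projective

/-! ### The radical is the annihilator of `e` -/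

section Radical

variable [IsSimpleModule (MonoidAlgebra k (MaxSubgroup e.1))ᵐᵒᵖ U]

variable (k U) in
-- If `N` is strictly larger, it contains some `t` with `te ≠ 0`, and `te` lies in `U ⊗ e`. The
-- vectors `u` with `u ⊗ e` in `N` form a nonzero `kH`-submodule of the simple module `U`, hence all
-- of `U`, and `U ⊗ e` generates.
theorem isCoatom_indKer : IsCoatom (indKer k e U) := by
  have : Nontrivial U := IsSimpleModule.nontrivial (MonoidAlgebra k (MaxSubgroup e.1))ᵐᵒᵖ U
  constructor
  · intro h
    obtain ⟨u, hu⟩ := exists_ne (0 : U)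
    have hmem : minTmul k e e.elt u ∈ indKer k e U := by rw [h]; trivial
    rw [mem_indKer, rightAct_idem, aug_elt] at hmem
    exact hu (by rw [← aug_elt (k := k) e u, hmem, map_zero])
  · intro N hN
    obtain ⟨t, htN, ht⟩ := SetLike.exists_of_lt hN
    let N' : Submodule (MonoidAlgebra k (MaxSubgroup e.1))ᵐᵒᵖ U :=
      submoduleOfRightAct ((N.restrictScalars k).comap (minTmul k e e.elt)) fun g u hu => by
        change minTmul k e e.elt (rightAct k g u) ∈ N
        have hcomm : minMul e.elt g.toS = mulMin g.toS e.elt :=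
          Subtype.ext (g.left.trans g.right.symm)
        rw [← minTmul_mulMin, ← hcomm, ← rightAct_minTmul]
        exact rightAct_mem N _ hu
    have hN' : ∀ u, u ∈ N' ↔ minTmul k e e.elt u ∈ N := fun u => Iff.rfl
    refine eq_top_of_minTmul_elt_mem e fun u => ?_
    rw [← hN']
    rcases eq_bot_or_eq_top N' with h | h
    · exfalso
      have hmem : aug k e U t ∈ N' := by
        rw [hN', ← rightAct_idem]
        exact rightAct_mem N _ htN
      rw [h, Submodule.mem_bot] at hmem
      exact ht ((mem_indKer e).2 (by rw [rightAct_idem, hmem, map_zero]))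
    · rw [h]
      trivial

variable (k U) in
/-- The radical of a module induced from the minimal ideal. -/
theorem jacobson_ind_min :
    Module.jacobson (MonoidAlgebra k S)ᵐᵒᵖ (Ind k e.1 U) = indKer k e U := by
  apply le_antisymm
  · exact sInf_le (isCoatom_indKer k e U)
  · refine le_sInf fun N hN => ?_
    by_contra hle
    -- Write `u ⊗ e = n + t` with `n` in `N` and `te = 0`. Multiplying by `e` gives `u ⊗ e = ne`,
    -- which lies in `N`, so `N` would be everything.
    have htop : N ⊔ indKer k e U = ⊤ := hN.2 _ (left_lt_sup.2 hle)
    refine hN.1 (eq_top_of_minTmul_elt_mem e fun u => ?_)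
    obtain ⟨n, hn, t, ht, hnt⟩ := Submodule.mem_sup.1
      (htop ▸ Submodule.mem_top : minTmul k e e.elt u ∈ N ⊔ indKer k e U)
    rw [← rightAct_elt_minTmul, ← hnt, map_add]
    change rightAct k e.1.1 n + rightAct k e.1.1 t ∈ N
    rw [(mem_indKer e).1 ht, add_zero]
    exact rightAct_mem N _ hn

end Radical

end MinimalIdeal

/-! ## The radical of an induced module and the bimodule `M` -/

section BimodMStructure

theorem KX.linearMap_ext {k : Type u} [Field k] {S : Type u} [Monoid S] {e : MinIdem S}
    {W : Type*} [AddCommGroup W] [Module k W] {f g : KX k e →ₗ[k] W}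
    (h : ∀ x : minimalIdeal S, f (Finsupp.single ⟦x⟧ 1) = g (Finsupp.single ⟦x⟧ 1)) : f = g :=
  Finsupp.lhom_ext' fun x => LinearMap.ext_ring (by
    induction x using Quotient.inductionOn with | _ x => exact h x)

variable (k : Type u) [Field k] {S : Type u} [Monoid S] [IsRRBG S] (e : MinIdem S)

instance : IsScalarTower k (MonoidAlgebra k (MaxSubgroup e.1)) (KX k e) where
  smul_assoc c a x := by
    change MonoidAlgebra.lift k _ _ (KX.leftRep k e) (c • a) x =
      c • MonoidAlgebra.lift k _ _ (KX.leftRep k e) a x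
    rw [map_smul, LinearMap.smul_apply]

instance : IsScalarTower k (MonoidAlgebra k (MaxSubgroup (oneIdem S)))ᵐᵒᵖ (KX k e) where
  smul_assoc c a x := by
    change AlgHom.opComm (MonoidAlgebra.lift k _ _ (KX.rightRep k e)) (c • a) x =
      c • AlgHom.opComm (MonoidAlgebra.lift k _ _ (KX.rightRep k e)) a x
    rw [map_smul, LinearMap.smul_apply]

theorem KX.rightAct_single (g : MaxSubgroup (oneIdem S)) (x : minimalIdeal S) :
    rightAct k g (Finsupp.single ⟦x⟧ 1 : KX k e) = Finsupp.single ⟦minMul x g.toS⟧ 1 := by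
  rw [rightAct_def, KX.op_single_smul, one_mul]
  rfl

theorem KX.single_smul_mk (h : MaxSubgroup e.1) (x : minimalIdeal S) :
    (MonoidAlgebra.single h (1 : k)) • (Finsupp.single ⟦x⟧ 1 : KX k e) =
      Finsupp.single ⟦mulMin h.toS x⟧ 1 := by
  rw [KX.single_smul, one_mul]
  rfl

/-- The action of `h ∈ H` on a left `kH`-module, as a linear map. -/
def leftAct {H : Type*} [Monoid H] {W : Type*} [AddCommGroup W] [Module k W]
    [Module (MonoidAlgebra k H) W] [IsScalarTower k (MonoidAlgebra k H) W] (h : H) :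
    W →ₗ[k] W where
  toFun w := MonoidAlgebra.single h (1 : k) • w
  map_add' := smul_add _
  map_smul' c w := smul_comm _ c w

instance : SMulCommClass (MonoidAlgebra k (MaxSubgroup e.1))
    (MonoidAlgebra k (MaxSubgroup (oneIdem S)))ᵐᵒᵖ (KX k e) :=
  smulCommClass_of_single (k := k) fun h g m => by
    have : leftAct k h ∘ₗ (rightAct k g : KX k e →ₗ[k] KX k e) = rightAct k g ∘ₗ leftAct k h :=
      KX.linearMap_ext (k := k) (e := e) fun x => by
        change MonoidAlgebra.single h (1 : k) •
            rightAct k g (Finsupp.single ⟦x⟧ 1 : KX k e) =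
          rightAct k g (MonoidAlgebra.single h (1 : k) • (Finsupp.single ⟦x⟧ 1 : KX k e))
        rw [KX.rightAct_single, KX.single_smul_mk, KX.single_smul_mk, KX.rightAct_single]
        congr 2
        exact Subtype.ext (mul_assoc _ _ _).symm
    exact LinearMap.congr_fun this m

instance : IsScalarTower k (MonoidAlgebra k (MaxSubgroup e.1)) (BimodM k e) where
  smul_assoc c a x := Subtype.ext (smul_assoc c a x.1)

instance : SMulCommClass (MonoidAlgebra k (MaxSubgroup e.1))
    (MonoidAlgebra k (MaxSubgroup (oneIdem S)))ᵐᵒᵖ (BimodM k e) where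
  smul_comm a b x := Subtype.ext (smul_comm a b x.1)

/-- The projection `kX → M` along the left `kH`-submodule generated by `[e]`. -/
def rho : KX k e →ₗ[k] BimodM k e where
  toFun y := ⟨y - eps k e y • Finsupp.single ⟦e.elt⟧ 1, by
    have : eps k e (Finsupp.single ⟦e.elt⟧ 1) = 1 := by
      rw [eps_single, MonoidAlgebra.one_def]
      congr 1
      exact minToH_elt e
    rw [LinearMap.mem_ker, map_sub, eps_left, this, mul_one, sub_self]⟩
  map_add' y z := Subtype.ext (by
    change y + z - eps k e (y + z) • _ = (y - _) + (z - _)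
    rw [map_add, add_smul, add_sub_add_comm])
  map_smul' c y := Subtype.ext (by
    change c • y - eps k e (c • y) • _ = c • (y - _)
    rw [map_smul, smul_assoc, smul_sub])

theorem rho_coe (m : BimodM k e) : rho k e m = m := Subtype.ext (by
  change m.1 - eps k e m.1 • _ = m.1
  rw [LinearMap.mem_ker.1 m.2, zero_smul, sub_zero])

theorem rho_smul (a : MonoidAlgebra k (MaxSubgroup e.1)) (y : KX k e) :
    rho k e (a • y) = a • rho k e y := Subtype.ext (by
  change a • y - eps k e (a • y) • _ = a • (y - _)
  rw [eps_left, smul_sub, mul_smul])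

/-- The subtracted term is `ε([x])[e] = (xe)[e] = [xe]`. -/
theorem rho_single_coe (x : minimalIdeal S) :
    (rho k e (Finsupp.single ⟦x⟧ 1)).1 =
      Finsupp.single ⟦x⟧ 1 - Finsupp.single ⟦minMul x e.1.1⟧ 1 := by
  change _ - eps k e _ • _ = _
  rw [eps_single, minMul_idem, ← KX.single_smul_mk]
  rfl

theorem rho_single_minMul_idem (x : minimalIdeal S) :
    rho k e (Finsupp.single ⟦minMul x e.1.1⟧ 1) = 0 := Subtype.ext (by
  rw [rho_single_coe]
  have : minMul (minMul x e.1.1) e.1.1 = minMul x e.1.1 :=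
    Subtype.ext (by change x.1 * e.1.1 * e.1.1 = x.1 * e.1.1; rw [mul_assoc, e.1.2.eq])
  rw [this, sub_self]
  rfl)

/-- This is `xese = xse`, from `ese = se`. -/
theorem minMul_idem_minMul_idem (x : minimalIdeal S) (s : S) :
    minMul (minMul (minMul x e.1.1) s) e.1.1 = minMul (minMul x s) e.1.1 :=
  Subtype.ext (by
    change x.1 * e.1.1 * s * e.1.1 = x.1 * s * e.1.1
    rw [mul_assoc, mul_assoc, IsRRBG.idem_mul, mul_assoc])

/-- Right translation by `g` need not preserve the complement spanned by the `[he]`, so `rho` itself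
need not be `G`-equivariant. The identity is `([x] - [xe])g = [xg] - [xeg]`: after `rho` the
correction terms `[xge]` and `[xege]` agree and cancel. -/
theorem rho_sub_eq_rightAct (g : MaxSubgroup (oneIdem S)) (x : minimalIdeal S) :
    rho k e (Finsupp.single ⟦minMul x g.toS⟧ 1) -
      rho k e (Finsupp.single ⟦minMul (minMul x e.1.1) g.toS⟧ 1) =
    rightAct k g (rho k e (Finsupp.single ⟦x⟧ 1)) := Subtype.ext (by
  change (rho k e _).1 - (rho k e _).1 = rightAct k g (rho k e (Finsupp.single ⟦x⟧ 1)).1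
  rw [rho_single_coe, rho_single_coe, rho_single_coe, map_sub, KX.rightAct_single,
    KX.rightAct_single, minMul_idem_minMul_idem, sub_sub_sub_cancel_right])

end BimodMStructure

/-! ### Non-units and the relation `≈` -/

section Approx

variable {S : Type u} [Monoid S] [IsRRBG S] [Finite S] (e : MinIdem S)

/-- If `w` lies in `J`, then `w = ew` and already `xw = xew = x'ew = x'w`. Otherwise take `t` with
`wtw = w`: the element `tw` fixes `xw` and `x'w`, and it is a non-unit outside `J`, so it witnesses
the generating relation. -/
theorem mk_minMul_eq_of_not_isUnit {w : S} (hw : ¬ IsUnit w) {x x' : minimalIdeal S}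
    (h : x.1 * e.1.1 = x'.1 * e.1.1) : (⟦minMul x w⟧ : X e) = ⟦minMul x' w⟧ := by
  by_cases hJ : w ∈ minimalIdeal S
  · congr 1
    refine Subtype.ext ?_
    change x.1 * w = x'.1 * w
    have hw : e.1.1 * w = w := minIdem_mul e ⟨w, hJ⟩
    rw [← hw, ← mul_assoc, ← mul_assoc, h]
  · obtain ⟨t, ht⟩ := IsRRBG.regular w
    refine Quotient.sound (Relation.EqvGen.rel _ _ ⟨?_, t * w, fun hu => hw ?_, fun hm => hJ ?_,
      ?_, ?_⟩)
    · change x.1 * w * e.1.1 = x'.1 * w * e.1.1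
      rw [mul_assoc, mul_assoc, ← IsRRBG.idem_mul, ← mul_assoc, ← mul_assoc x'.1, h]
    -- If the idempotent `tw` were a unit it would be `1`, and then `w` would be a unit by
    -- finiteness.
    · have h1 : t * w = 1 := by
        refine hu.mul_left_cancel ?_
        rw [mul_one, mul_assoc, ← mul_assoc w, ht]
      have ht : IsUnit t := isUnit_of_mul_eq_one_of_finite h1
      exact isUnit_of_inverses (ht.mul_left_cancel (by rw [← mul_assoc, h1, one_mul, mul_one])) h1
    · rw [← ht, mul_assoc]
      exact minimalIdeal_mul_left hm w
    · change x.1 * w * (t * w) = x.1 * w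
      rw [mul_assoc, ← mul_assoc w, ht]
    · change x'.1 * w * (t * w) = x'.1 * w
      rw [mul_assoc, ← mul_assoc w, ht]

end Approx

/-! ### Homomorphisms from the radical and from `U ⊗ M` -/

section Comparison

variable {k : Type u} [Field k] {S : Type u} [Monoid S] [IsRRBG S] (e : MinIdem S)
  (U : Type u) [AddCommGroup U] [Module k U] [Module (MonoidAlgebra k (MaxSubgroup e.1))ᵐᵒᵖ U]

variable (k) in
/-- The tensor product `U ⊗_{kH} M`. -/
abbrev tensorM : Type u :=
  BalancedTensor k (B := MonoidAlgebra k (MaxSubgroup e.1))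
    (MonoidAlgebra k (MaxSubgroup (oneIdem S))) U (BimodM k e)

variable {U} in
variable (k) in
/-- The element `u ⊗ m` of `U ⊗_{kH} M`. -/
def mTmul (m : BimodM k e) : U →ₗ[k] tensorM k e U := BalancedTensor.mk m

variable {U} in
theorem rightAct_mTmul (g : MaxSubgroup (oneIdem S)) (m : BimodM k e) (u : U) :
    rightAct k g (mTmul k e m u) = mTmul k e (rightAct k g m) u :=
  BalancedTensor.rightAct_mk g m u

variable {U} in
theorem mTmul_sub (m n : BimodM k e) (u : U) :
    mTmul k e (m - n) u = mTmul k e m u - mTmul k e n u :=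
  LinearMap.congr_fun ((BalancedTensor.mkBilin : BimodM k e →ₗ[k] U →ₗ[k] tensorM k e U).map_sub
    m n) u

variable {U} in
theorem mTmul_zero (u : U) : mTmul k e 0 u = 0 :=
  LinearMap.congr_fun (BalancedTensor.mkBilin : BimodM k e →ₗ[k] U →ₗ[k] tensorM k e U).map_zero u

variable (k) in
/-- The projection `t ↦ t - te` of the induced module onto its radical. -/
def indProj : Ind k e.1 U →ₗ[k] indKer k e U where
  toFun t := ⟨t - rightAct k e.1.1 t, sub_rightAct_idem_mem e t⟩
  map_add' s t := Subtype.ext (by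
    change s + t - rightAct k e.1.1 (s + t) = (s - _) + (t - _)
    rw [map_add, add_sub_add_comm])
  map_smul' c t := Subtype.ext (by
    change c • t - rightAct k e.1.1 (c • t) = c • (t - _)
    rw [map_smul, smul_sub])

theorem indProj_coe (t : indKer k e U) : indProj k e U t.1 = t := Subtype.ext (by
  change t.1 - rightAct k e.1.1 t.1 = t.1
  rw [(mem_indKer e).1 t.2, sub_zero])

theorem indProj_rightAct_idem (t : Ind k e.1 U) : indProj k e U (rightAct k e.1.1 t) = 0 :=
  Subtype.ext (by
    change rightAct k e.1.1 t - rightAct k e.1.1 (rightAct k e.1.1 t) = 0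
    rw [← rightAct_mul, e.1.2.eq, sub_self])

theorem rightAct_indProj (s : S) (t : Ind k e.1 U) :
    rightAct k s (indProj k e U t) =
      indProj k e U (rightAct k s (t - rightAct k e.1.1 t)) :=
  (indProj_coe e U (rightAct k s (indProj k e U t))).symm

variable {U} in
/-- Homomorphisms from `Ind(U)` to a module on which the non-units act as zero vanish on the
radical. -/
theorem map_eq_zero_of_mem_indKer {N : Type*} [AddCommGroup N] [Module k N]
    [Module (MonoidAlgebra k S)ᵐᵒᵖ N] [IsScalarTower k (MonoidAlgebra k S)ᵐᵒᵖ N]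
    (hN : ∀ s : S, ¬ IsUnit s → ∀ n : N, rightAct k s n = 0)
    (f : Ind k e.1 U →ₗ[(MonoidAlgebra k S)ᵐᵒᵖ] N)
    {t : Ind k e.1 U} (ht : t ∈ indKer k e U) : f t = 0 := by
  rw [mem_indKer] at ht
  -- If `e` is a unit then `e = 1`, and `te = 0` means `t = 0`. Otherwise `u ⊗ x = (u ⊗ e)ex`, so
  -- `f` vanishes everywhere because `e` acts as zero on `N`.
  by_cases he : IsUnit e.1.1
  · have h1 : e.1.1 = 1 := he.mul_left_cancel (by rw [e.1.2.eq, mul_one])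
    rw [h1, rightAct_one] at ht
    rw [ht, map_zero]
  · have hzero : f.restrictScalars k = 0 := minTmul_ext e fun x u => by
      change f _ = 0
      rw [← rightAct_elt_minTmul, ← rightAct_elt_minTmul e e.elt u, map_rightAct, map_rightAct]
      change rightAct k x.1 (rightAct k e.1.1 _) = 0
      rw [hN _ he, map_zero]
    exact LinearMap.congr_fun hzero t

variable {U} in
/-- A linear map on `Ind(U)` that kills `tw` for `te = 0` and `w` a non-unit is constant on the
classes of `≈`. -/
theorem exists_linearMap_kx {V : Type*} [AddCommGroup V] [Module k V]
    (γ : Ind k e.1 U →ₗ[k] V)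
    (hγ : ∀ w : S, ¬ IsUnit w → ∀ t, rightAct k e.1.1 t = 0 → γ (rightAct k w t) = 0) :
    ∃ φ : KX k e →ₗ[k] U →ₗ[k] V, ∀ x u, φ (Finsupp.single ⟦x⟧ 1) u = γ (minTmul k e x u) := by
  have hsmile : ∀ x x', Smile e x x' → γ ∘ₗ minTmul k e x = γ ∘ₗ minTmul k e x' := by
    rintro x x' ⟨hxx, w, hw, -, hx, hx'⟩
    refine LinearMap.ext fun u => sub_eq_zero.1 ?_
    rw [LinearMap.comp_apply, LinearMap.comp_apply, ← map_sub]
    -- The difference is killed by `e` and fixed by `w`, so it has the form `tw` with `te = 0`, to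
    -- which `hγ` applies.
    have hfix : rightAct k w (minTmul k e x u - minTmul k e x' u) =
        minTmul k e x u - minTmul k e x' u := by
      rw [map_sub, rightAct_minTmul, rightAct_minTmul,
        show minMul x w = x from Subtype.ext hx, show minMul x' w = x' from Subtype.ext hx']
    rw [← hfix]
    refine hγ w hw _ ?_
    rw [map_sub, rightAct_minTmul, rightAct_minTmul,
      show minMul x e.1.1 = minMul x' e.1.1 from Subtype.ext hxx, sub_self]
  have happrox : ∀ x x', (approx e).r x x' → γ ∘ₗ minTmul k e x = γ ∘ₗ minTmul k e x' := by
    intro x x' h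
    change Relation.EqvGen (Smile e) x x' at h
    induction h with
    | rel x y h => exact hsmile x y h
    | refl x => rfl
    | symm x y _ ih => exact ih.symm
    | trans x y z _ _ h1 h2 => exact h1.trans h2
  refine ⟨Finsupp.linearCombination k (Quotient.lift (fun x => γ ∘ₗ minTmul k e x) happrox),
    fun x u => ?_⟩
  rw [Finsupp.linearCombination_single, one_smul]
  rfl

variable [IsScalarTower k (MonoidAlgebra k (MaxSubgroup e.1))ᵐᵒᵖ U]

variable (k) in
/-- The linear map `Ind(U) → U ⊗ M` sending `u ⊗ x` to `u ⊗ ([x] - [xe])`. -/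
def indToTensor : Ind k e.1 U →ₗ[k] tensorM k e U :=
  minLift e (fun x => mTmul k e (rho k e (Finsupp.single ⟦x⟧ 1))) fun h x u => by
    rw [← KX.single_smul_mk, rho_smul]
    exact BalancedTensor.mk_balanced _ _ _

theorem indToTensor_minTmul (x : minimalIdeal S) (u : U) :
    indToTensor k e U (minTmul k e x u) = mTmul k e (rho k e (Finsupp.single ⟦x⟧ 1)) u :=
  minLift_minTmul _ _ _ _ _

theorem indToTensor_rightAct_idem (t : Ind k e.1 U) :
    indToTensor k e U (rightAct k e.1.1 t) = 0 := by
  have : indToTensor k e U ∘ₗ rightAct k e.1.1 = 0 := minTmul_ext e fun x u => by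
    rw [LinearMap.comp_apply, rightAct_minTmul, indToTensor_minTmul, rho_single_minMul_idem,
      mTmul_zero, LinearMap.zero_apply]
  exact LinearMap.congr_fun this t

/-- Stated for `t - te` rather than for `t` in the radical, so that it is a linear identity on the
whole induced module and can be checked on the tensors `u ⊗ x`; on the radical `t - te = t`. -/
theorem indToTensor_rightAct_sub (g : MaxSubgroup (oneIdem S)) (t : Ind k e.1 U) :
    indToTensor k e U (rightAct k g.toS (t - rightAct k e.1.1 t)) =
      rightAct k g (indToTensor k e U t) := by
  have : indToTensor k e U ∘ₗ rightAct k g.toS ∘ₗ (LinearMap.id - rightAct k e.1.1) =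
      rightAct k g ∘ₗ indToTensor k e U := minTmul_ext e fun x u => by
    simp only [LinearMap.comp_apply, LinearMap.sub_apply, LinearMap.id_apply, map_sub,
      rightAct_minTmul, indToTensor_minTmul, rightAct_mTmul]
    rw [← mTmul_sub, rho_sub_eq_rightAct]
  exact LinearMap.congr_fun this t

/-- The elements `x` and `xe` have the same product with `e`, hence `[xw] = [xew]` for every
non-unit `w`. -/
theorem indToTensor_rightAct_sub_of_not_isUnit [Finite S] {w : S} (hw : ¬ IsUnit w)
    (t : Ind k e.1 U) : indToTensor k e U (rightAct k w (t - rightAct k e.1.1 t)) = 0 := by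
  have : indToTensor k e U ∘ₗ rightAct k w ∘ₗ (LinearMap.id - rightAct k e.1.1) = 0 :=
    minTmul_ext e fun x u => by
      simp only [LinearMap.comp_apply, LinearMap.sub_apply, LinearMap.id_apply, map_sub,
        rightAct_minTmul, indToTensor_minTmul, LinearMap.zero_apply]
      rw [mk_minMul_eq_of_not_isUnit e hw (x := minMul x e.1.1) (x' := x), sub_self]
      change x.1 * e.1.1 * e.1.1 = _
      rw [mul_assoc, e.1.2.eq]
  exact LinearMap.congr_fun this t

theorem indToTensor_rightAct {t : Ind k e.1 U} (ht : t ∈ indKer k e U)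
    (g : MaxSubgroup (oneIdem S)) :
    indToTensor k e U (rightAct k g.toS t) = rightAct k g (indToTensor k e U t) := by
  rw [← indToTensor_rightAct_sub, (mem_indKer e).1 ht, sub_zero]

theorem indToTensor_rightAct_of_not_isUnit [Finite S] {t : Ind k e.1 U}
    (ht : t ∈ indKer k e U) {w : S} (hw : ¬ IsUnit w) :
    indToTensor k e U (rightAct k w t) = 0 := by
  rw [← indToTensor_rightAct_sub_of_not_isUnit e U hw t, (mem_indKer e).1 ht, sub_zero]

/-- The map hits all tensors because `rho` is the identity on `M`, and `t` may be replaced by `t -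
te`, which lies in the radical and has the same image. -/
theorem exists_indToTensor_eq (q : tensorM k e U) :
    ∃ t ∈ indKer k e U, indToTensor k e U t = q := by
  suffices h : q ∈ LinearMap.range (indToTensor k e U) by
    obtain ⟨t, rfl⟩ := h
    exact ⟨_, sub_rightAct_idem_mem e t, by
      rw [map_sub, indToTensor_rightAct_idem, sub_zero]⟩
  induction q using BalancedTensor.induction with
  | hz => exact Submodule.zero_mem _
  | hadd x y hx hy => exact Submodule.add_mem _ hx hy
  | hmk m u =>
    suffices h : ∀ y : KX k e, mTmul k e (rho k e y) u ∈ LinearMap.range (indToTensor k e U) by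
      have := h m.1
      rwa [rho_coe] at this
    intro y
    let L : KX k e →ₗ[k] tensorM k e U := BalancedTensor.mkBilin.flip u ∘ₗ rho k e
    change L y ∈ _
    induction y using Finsupp.induction_linear with
    | zero => rw [map_zero]; exact Submodule.zero_mem _
    | add x y hx hy => rw [map_add]; exact Submodule.add_mem _ hx hy
    | single x c =>
      rw [← mul_one c, ← smul_eq_mul, ← Finsupp.smul_single, map_smul]
      refine Submodule.smul_mem _ _ ?_
      induction x using Quotient.inductionOn with | _ x => ?_
      exact ⟨minTmul k e x u, indToTensor_minTmul e U x u⟩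

variable {U} {V : Type u} [AddCommGroup V] [Module k V]

variable [Module (MonoidAlgebra k (MaxSubgroup (oneIdem S)))ᵐᵒᵖ V]
  [IsScalarTower k (MonoidAlgebra k (MaxSubgroup (oneIdem S)))ᵐᵒᵖ V]

/-- A linear map on `Ind(U)` that vanishes on `Ind(U)e`, is `G`-equivariant on the radical, and
kills the translates of the radical by non-units, factors through `U ⊗ M`. -/
theorem exists_linearMap_tensorM (γ : Ind k e.1 U →ₗ[k] V)
    (hγ : ∀ w : S, ¬ IsUnit w → ∀ t, rightAct k e.1.1 t = 0 → γ (rightAct k w t) = 0)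
    (hγ_idem : ∀ t, γ (rightAct k e.1.1 t) = 0)
    (hγ_act : ∀ (g : MaxSubgroup (oneIdem S)) t,
      γ (rightAct k g.toS (t - rightAct k e.1.1 t)) = rightAct k g (γ t)) :
    ∃ F : tensorM k e U →ₗ[(MonoidAlgebra k (MaxSubgroup (oneIdem S)))ᵐᵒᵖ] V,
      ∀ t, F (indToTensor k e U t) = γ t := by
  obtain ⟨φ, hφ⟩ := exists_linearMap_kx e γ hγ
  have hφ_rho : ∀ x u, φ (rho k e (Finsupp.single ⟦x⟧ 1)).1 u = γ (minTmul k e x u) :=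
    fun x u => by
      rw [rho_single_coe, map_sub, LinearMap.sub_apply, hφ, hφ, ← rightAct_minTmul, hγ_idem,
        sub_zero]
  have hbal : ∀ (m : KX k e) (h : MaxSubgroup e.1) (u : U),
      φ (MonoidAlgebra.single h (1 : k) • m) u = φ m (rightAct k h u) := fun m h u => by
    have : φ.flip u ∘ₗ leftAct k h = φ.flip (rightAct k h u) := KX.linearMap_ext fun x => by
      change φ (MonoidAlgebra.single h (1 : k) • _) u = φ _ (rightAct k h u)
      rw [KX.single_smul_mk, hφ, hφ, minTmul_mulMin]
    exact LinearMap.congr_fun this m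
  obtain ⟨F, hF⟩ : ∃ F : tensorM k e U →ₗ[k] V, ∀ m u, F (mTmul k e m u) = φ m.1 u :=
    let ψ : BimodM k e →ₗ[k] U →ₗ[k] V := φ ∘ₗ (LinearMap.ker (eps k e)).subtype
    have hψ : ∀ (m : BimodM k e) (h : MaxSubgroup e.1) (u : U),
        ψ (MonoidAlgebra.single h (1 : k) • m) u = ψ m (rightAct k h u) :=
      fun m h u => hbal m.1 h u
    ⟨BalancedTensor.lift ψ (BalancedTensor.balanced_of_single (M := BimodM k e) ψ hψ),
      fun _ _ => rfl⟩
  have hF_act : ∀ (g : MaxSubgroup (oneIdem S)) q, F (rightAct k g q) = rightAct k g (F q) := by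
    intro g q
    -- Equivariance is tested after pulling back along the surjection from `Ind(U)`, where it
    -- reduces to the tensors `u ⊗ x` and follows from `hγ_act`.
    obtain ⟨t, ht, rfl⟩ := exists_indToTensor_eq e U q
    have : F ∘ₗ rightAct k g ∘ₗ indToTensor k e U =
        rightAct k g ∘ₗ F ∘ₗ indToTensor k e U := minTmul_ext e fun x u => by
      simp only [LinearMap.comp_apply]
      rw [indToTensor_minTmul, rightAct_mTmul, hF, hF, hφ_rho, ← rho_sub_eq_rightAct]
      change φ ((rho k e _).1 - (rho k e _).1) u = _
      rw [map_sub, LinearMap.sub_apply, hφ_rho, hφ_rho, ← hγ_act, map_sub (rightAct k g.toS),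
        rightAct_minTmul, rightAct_minTmul, rightAct_minTmul, map_sub]
    exact LinearMap.congr_fun this t
  refine ⟨linearMapOfRightAct F hF_act, fun t => ?_⟩
  have : F ∘ₗ indToTensor k e U = γ := minTmul_ext e fun x u => by
    rw [LinearMap.comp_apply, indToTensor_minTmul, hF, hφ_rho]
  exact LinearMap.congr_fun this t

variable {N : Type u} [AddCommGroup N] [Module k N] [Module (MonoidAlgebra k S)ᵐᵒᵖ N]
  [IsScalarTower k (MonoidAlgebra k S)ᵐᵒᵖ N] (j : V ≃ₗ[k] N)
  (hj : ∀ (g : MaxSubgroup (oneIdem S)) (v : V), j (rightAct k g v) = rightAct k g.toS (j v))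
  (hj' : ∀ (s : S), ¬ IsUnit s → ∀ v : V, rightAct k s (j v) = 0)

include hj hj' in
/-- Every homomorphism from the radical of `Ind(U)` to a module on which the non-units act as
zero factors through `U ⊗ M`. -/
theorem exists_factor (f : indKer k e U →ₗ[(MonoidAlgebra k S)ᵐᵒᵖ] N) :
    ∃ F : tensorM k e U →ₗ[(MonoidAlgebra k (MaxSubgroup (oneIdem S)))ᵐᵒᵖ] V,
      ∀ t : indKer k e U, j (F (indToTensor k e U t.1)) = f t := by
  -- `f` is extended from the radical to all of `Ind(U)` by precomposing with `t ↦ t - te`; the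
  -- extension vanishes on `Ind(U)e`.
  obtain ⟨γ, hγ⟩ : ∃ γ : Ind k e.1 U →ₗ[k] V, ∀ t, j (γ t) = f (indProj k e U t) :=
    ⟨j.symm.toLinearMap ∘ₗ f.restrictScalars k ∘ₗ indProj k e U, fun t => j.apply_symm_apply _⟩
  obtain ⟨F, hF⟩ := exists_linearMap_tensorM e γ
    (fun w hw t ht => j.injective (by
      have h := rightAct_indProj e U w t
      rw [ht, sub_zero] at h
      rw [hγ, map_zero, ← h, map_rightAct, ← hγ, hj' w hw]))
    (fun t => j.injective (by rw [hγ, indProj_rightAct_idem, map_zero, map_zero]))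
    (fun g t => j.injective (by rw [hγ, hj, hγ, ← rightAct_indProj, map_rightAct]))
  exact ⟨F, fun t => by rw [hF, hγ, indProj_coe]⟩

include hj hj' in
/-- Homomorphisms from the radical of `Ind(U)` to a module on which the non-units act as zero
correspond to homomorphisms from `U ⊗ M`. -/
theorem rank_hom_indKer [Finite S] :
    Module.rank k (indKer k e U →ₗ[(MonoidAlgebra k S)ᵐᵒᵖ] N) =
      Module.rank k
        (tensorM k e U →ₗ[(MonoidAlgebra k (MaxSubgroup (oneIdem S)))ᵐᵒᵖ] V) := by
  let Θ : (tensorM k e U →ₗ[(MonoidAlgebra k (MaxSubgroup (oneIdem S)))ᵐᵒᵖ] V) →ₗ[k]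
      (indKer k e U →ₗ[(MonoidAlgebra k S)ᵐᵒᵖ] N) :=
    { toFun := fun F => linearMapOfRightAct (j.toLinearMap ∘ₗ F.restrictScalars k ∘ₗ
        indToTensor k e U ∘ₗ (indKer k e U).subtype.restrictScalars k) fun s t => by
          change j (F (indToTensor k e U (rightAct k s t.1))) =
            rightAct k s (j (F (indToTensor k e U t.1)))
          by_cases hs : IsUnit s
          · obtain ⟨g, rfl⟩ := exists_toS_eq hs
            rw [indToTensor_rightAct e U t.2, map_rightAct, hj]
          · rw [indToTensor_rightAct_of_not_isUnit e U t.2 hs, map_zero, map_zero, hj' s hs]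
      map_add' := fun F F' => LinearMap.ext fun t => j.map_add _ _
      map_smul' := fun c F => LinearMap.ext fun t => j.map_smul _ _ }
  have hΘ : ∀ F t, Θ F t = j (F (indToTensor k e U t.1)) := fun _ _ => rfl
  refine (LinearEquiv.ofBijective Θ
    ⟨fun F F' h => LinearMap.ext fun q => ?_, fun f => ?_⟩).rank_eq.symm
  -- Injectivity: the radical already surjects onto `U ⊗ M`.
  · obtain ⟨t, ht, rfl⟩ := exists_indToTensor_eq e U q
    exact j.injective (LinearMap.congr_fun h ⟨t, ht⟩)
  · obtain ⟨F, hF⟩ := exists_factor e j hj hj' f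
    exact ⟨F, LinearMap.ext hF⟩

end Comparison

/-- A simple module over a finite-dimensional algebra is finite-dimensional. -/
theorem finiteDimensional_of_isSimpleModule (k : Type*) [Field k] {R : Type*} [Ring R]
    [Algebra k R] [FiniteDimensional k R] (V : Type*) [AddCommGroup V] [Module k V] [Module R V]
    [IsScalarTower k R V] [IsSimpleModule R V] : FiniteDimensional k V :=
  Module.Finite.trans R V

end RRBG

end

theorem theorem5p14 {k S : Type u} [Field k] [IsAlgClosed k]
    [Monoid S] [Finite S] [RRBG.IsRRBG S]
    (hchar : ∀ f : RRBG.Idem S, ¬ ringChar k ∣ Nat.card (RRBG.MaxSubgroup f))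
    (e : RRBG.MinIdem S)
    (U : Type u) [AddCommGroup U] [Module k U]
    [Module (MonoidAlgebra k (RRBG.MaxSubgroup e.1))ᵐᵒᵖ U]
    [IsScalarTower k (MonoidAlgebra k (RRBG.MaxSubgroup e.1))ᵐᵒᵖ U]
    [IsSimpleModule (MonoidAlgebra k (RRBG.MaxSubgroup e.1))ᵐᵒᵖ U]
    (V : Type u) [AddCommGroup V] [Module k V]
    [Module (MonoidAlgebra k (RRBG.MaxSubgroup (RRBG.oneIdem S)))ᵐᵒᵖ V]
    [IsScalarTower k (MonoidAlgebra k (RRBG.MaxSubgroup (RRBG.oneIdem S)))ᵐᵒᵖ V]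
    [IsSimpleModule (MonoidAlgebra k (RRBG.MaxSubgroup (RRBG.oneIdem S)))ᵐᵒᵖ V] :
    ∃ m : ℕ,
      RRBG.IsCompositionMultiplicity
        (MonoidAlgebra k (RRBG.MaxSubgroup (RRBG.oneIdem S)))ᵐᵒᵖ V
        (RRBG.BalancedTensor k (B := MonoidAlgebra k (RRBG.MaxSubgroup e.1))
          (MonoidAlgebra k (RRBG.MaxSubgroup (RRBG.oneIdem S))) U (RRBG.BimodM k e)) m ∧
      Module.rank k
        (CategoryTheory.Abelian.Ext
          (ModuleCat.of (MonoidAlgebra k S)ᵐᵒᵖ (RRBG.Tilde k e.1 U))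
          (ModuleCat.of (MonoidAlgebra k S)ᵐᵒᵖ (RRBG.Tilde k (RRBG.oneIdem S) V)) 1) = m := by
  have hcard : ∀ f : RRBG.Idem S, (Nat.card (RRBG.MaxSubgroup f) : k) ≠ 0 := fun f h =>
    hchar f ((ringChar.spec k _).1 h)
  -- This is the hypothesis of Maschke's theorem, from which `kG` and its opposite are semisimple.
  have : NeZero (Nat.card (RRBG.MaxSubgroup (RRBG.oneIdem S)) : k) := ⟨hcard _⟩
  have : FiniteDimensional k (MonoidAlgebra k (RRBG.MaxSubgroup (RRBG.oneIdem S)))ᵐᵒᵖ :=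
    Module.Finite.equiv (MulOpposite.opLinearEquiv k)
  have : FiniteDimensional k (MonoidAlgebra k (RRBG.MaxSubgroup e.1))ᵐᵒᵖ :=
    Module.Finite.equiv (MulOpposite.opLinearEquiv k)
  have : FiniteDimensional k V := RRBG.finiteDimensional_of_isSimpleModule k
    (R := (MonoidAlgebra k (RRBG.MaxSubgroup (RRBG.oneIdem S)))ᵐᵒᵖ) V
  have : FiniteDimensional k U := RRBG.finiteDimensional_of_isSimpleModule k
    (R := (MonoidAlgebra k (RRBG.MaxSubgroup e.1))ᵐᵒᵖ) U
  have : FiniteDimensional k (RRBG.tensorM k e U) := RRBG.BalancedTensor.finiteDimensional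
  have := RRBG.finite_hom (k := k) (V := V)
    (R := (MonoidAlgebra k (RRBG.MaxSubgroup (RRBG.oneIdem S)))ᵐᵒᵖ) (RRBG.tensorM k e U)
  refine ⟨_, RRBG.isCompositionMultiplicity_finrank_hom (k := k) (RRBG.tensorM k e U), ?_⟩
  obtain ⟨j, hj, hj'⟩ := RRBG.exists_equiv_tilde_one (k := k) (S := S) V
  have := RRBG.projective_ind_min (U := U) e (hcard e.1)
  rw [RRBG.rank_ext_one_quotient, RRBG.jacobson_ind_min, RRBG.rank_hom_indKer e j hj hj',
    Module.finrank_eq_rank]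
  -- What remains is the hypothesis of the dimension shift: homomorphisms from `Ind(U)` to `Ṽ`
  -- vanish on the radical.
  intro f t ht
  rw [RRBG.jacobson_ind_min] at ht
  refine RRBG.map_eq_zero_of_mem_indKer e (fun s hs n => ?_) f ht
  obtain ⟨v, rfl⟩ := j.surjective n
  exact hj' s hs v
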